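/- **Setting.** Let $(X,\|\cdot\|)$ be a (real or complex) Banach space, and let $\{L(t,\tau)\}_{t\ge\tau}\subset\mathcal L(X)$ be a linear evolution process: $L(t,t)=I$, $L(t,\tau)=L(t,s)L(s,\tau)$ for $t\ge s\ge\tau$, and $(t,\tau)\mapsto L(t,\tau)\eta$ is continuous on $\{t\ge\tau\}$ for each $\eta\in X$. Assume that it has an exponential splitting with bound $M\ge1$, exponents $\gamma>\rho$ and projections $Q(t)\in\mathcal L(X)$, $t\in\mathbb R$: for $t\ge\tau$ we have $Q(t)L(t,\tau)=L(t,\tau)Q(\tau)$, the map $L(t,\tau)\colon Q(\tau)X\to Q(t)X$ is an isomorphism, whose inverse is denoted by $L(\tau,t)$, and $$e^{\gamma(t-\tau)}\|L(t,\tau)(I-Q(\tau))\|\le M\ \ (t\ge\tau),\qquad e^{\rho(t-\tau)}\|L(t,\tau)Q(\tau)\|\le M\ \ (t\le\tau).$$ Put $N(\tau)=Q(\tau)X$, $S(\tau)=(I-Q(\tau))X$, and $$|x|_{N(\tau)}=\sup_{t\le\tau}e^{\rho(t-\tau)}\|L(t,\tau)x\|\ (x\in N(\tau)),\qquad |x|_{S(\tau)}=\sup_{t\ge\tau}e^{\gamma(t-\tau)}\|L(t,\tau)x\|\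 (x\in S(\tau)).$$ Let $\Gamma$ be a norm on $\mathbb R^2$ such that $\Gamma(a,\cdot)$ and $\Gamma(\cdot,b)$ are nondecreasing on $[0,\infty)$ for all $a,b\ge0$, and let $\|x\|_\tau=\Gamma\big(|Q(\tau)x|_{N(\tau)},|(I-Q(\tau))x|_{S(\tau)}\big)$ for $x\in X$. Let $f\colon\mathbb R\times X\to X$ be continuous with $f(t,0)=0$ for all $t$, and let $L_1,L_2>0$ be such that for all $t\in\mathbb R$, $u,v\in X$ $$|Q(t)(f(t,u)-f(t,v))|_{N(t)}\le L_1\|u-v\|_t,\qquad |(I-Q(t))(f(t,u)-f(t,v))|_{S(t)}\le L_2\|u-v\|_t.$$ Let $\{T(t,\tau)\}_{t\ge\tau}$ be an evolution process of maps $X\to X$ (that is, $T(t,t)=I$, $T(t,s)T(s,\tau)=T(t,\tau)$ for $t\ge s\ge\tau$, and $t\mapsto T(t,\tau)\eta$ is continuous on $[\tau,\infty)$) satisfying $$T(t,\tau)\eta=L(t,\tau)\eta+\int_\tau^tL(t,s)f(s,T(s,\tau)\eta)\,ds,\qquad t\ge\tau,\ \eta\in X.$$ Assume the gap condition: $\sigma\in(\rho,\gamma)$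 and $\Gamma\big(\tfrac{L_1}{\sigma-\rho},\tfrac{L_2}{\gamma-\sigma}\big)<1$. Assume finally that for every $t\in\mathbb R$ the map $f(t,\cdot)$ is Fréchet differentiable on $X$ and that its derivative $Df(t,\cdot)\colon X\to\mathcal L(X)$ is continuous for the operator norm. Let $E_{\sigma,\tau}$ be the space of continuous $z\colon(-\infty,\tau]\to X$ with $\sup_{t\le\tau}e^{\sigma(t-\tau)}\|z(t)\|_t<\infty$. Let $\mathcal M(t)$ be the set of all $\eta\in X$ for which there is $z\colon\mathbb R\to X$ with $T(s,r)z(r)=z(s)$ for all $s\ge r$, $z(t)=\eta$ and $\sup_{r\le t}e^{\sigma r}\|z(r)\|_r<\infty$. **Theorem 6.1.** For all $\tau\in\mathbb R$ and $\eta\in X$ there is a unique $z_{\tau,\eta}\in E_{\sigma,\tau}$ such that for all $t\le\tau$ $$z_{\tau,\eta}(t)=L(t,\tau)Q(\tau)\eta-\int_t^\tau L(t,s)Q(s)f(s,z_{\tau,\eta}(s))\,ds+\int_{-\infty}^tL(t,s)(I-Q(s))f(s,z_{\tau,\eta}(s))\,ds,$$ where the improper integral converges absolutely. Define $$\Sigma(\tau,\eta)=(I-Q(\tau))z_{\tau,\eta}(\tau)=\int_{-\infty}^\tau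 L(\tau,s)(I-Q(s))f(s,z_{\tau,\eta}(s))\,ds.$$ Then $\mathcal M(t)=\{Q(t)\eta+\Sigma(t,Q(t)\eta)\colon\eta\in X\}$ for all $t$, and $T(t,\tau)\mathcal M(\tau)=\mathcal M(t)$ for all $t\ge\tau$. For every $\tau\in\mathbb R$ the map $\Sigma(\tau,\cdot)\colon X\to X$ is Fréchet differentiable, and its derivative is continuous: for every $\eta\in X$ $$D_\eta\Sigma(\tau,\eta+h)\to D_\eta\Sigma(\tau,\eta)\ \text{ in }\mathcal L(X)\ \text{ as }h\to0.$$ Hence the invariant manifold is $C^1$: each $\mathcal M(t)$ is the graph of a $C^1$ map from $N(t)$ to $S(t)$ (in particular when $\{\mathcal M(t)\}$ is an inertial manifold). -/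

import Mathlib

open Set Filter Topology MeasureTheory

noncomputable section

namespace InertialC1

variable {𝕜 : Type*} [RCLike 𝕜]
variable {X : Type*} [NormedAddCommGroup X] [NormedSpace ℝ X] [NormedSpace 𝕜 X]

/-- A linear evolution process `L(t, τ)`, `t ≥ τ`. The values `L t τ` with `t < τ` are irrelevant. -/
structure IsLinearEvolutionProcess (L : ℝ → ℝ → X →L[𝕜] X) : Prop where
  comp : ∀ τ s t : ℝ, τ ≤ s → s ≤ t → L t τ = (L t s).comp (L s τ)
  refl : ∀ t : ℝ, L t t = ContinuousLinearMap.id 𝕜 X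
  cont : ∀ η : X, ContinuousOn (fun p : ℝ × ℝ => L p.1 p.2 η) {p : ℝ × ℝ | p.2 ≤ p.1}

/-- A (nonlinear) evolution process `T(t, τ)`, `t ≥ τ`. -/
structure IsEvolutionProcess (T : ℝ → ℝ → X → X) : Prop where
  comp : ∀ τ s t : ℝ, τ ≤ s → s ≤ t → ∀ η : X, T t s (T s τ η) = T t τ η
  refl : ∀ (t : ℝ) (η : X), T t t η = η
  cont : ∀ (τ : ℝ) (η : X), ContinuousOn (fun t => T t τ η) (Ici τ)

/-- The backward operator `L(t, τ) : Q(τ)X → Q(t)X` for `t ≤ τ`, that is, the inverse of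
`L(τ, t) : Q(t)X → Q(τ)X`, evaluated at `y ∈ Q(τ)X`. -/
def backward (L : ℝ → ℝ → X →L[𝕜] X) (Q : ℝ → X →L[𝕜] X) (t τ : ℝ) (y : X) : X :=
  Function.invFunOn (L τ t) (range (Q t)) y

/-- Exponential splitting with bound `M`, exponents `γ > ρ` and projections `Q(t)`. -/
structure HasExponentialSplitting (L : ℝ → ℝ → X →L[𝕜] X) (Q : ℝ → X →L[𝕜] X)
    (M γ ρ : ℝ) : Prop where
  one_le : 1 ≤ M
  lt : ρ < γ
  proj : ∀ t : ℝ, (Q t).comp (Q t) = Q t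
  comm : ∀ τ t : ℝ, τ ≤ t → (Q t).comp (L t τ) = (L t τ).comp (Q τ)
  iso : ∀ τ t : ℝ, τ ≤ t → BijOn (L t τ) (range (Q τ)) (range (Q t))
  stable : ∀ τ t : ℝ, τ ≤ t →
    Real.exp (γ * (t - τ)) * ‖(L t τ).comp (ContinuousLinearMap.id 𝕜 X - Q τ)‖ ≤ M
  unstable : ∀ τ t : ℝ, t ≤ τ → ∀ x : X,
    Real.exp (ρ * (t - τ)) * ‖backward L Q t τ (Q τ x)‖ ≤ M * ‖x‖

/-- The norm `|y|_{N(τ)} = sup_{t ≤ τ} e^{ρ(t - τ)} ‖L(t, τ) y‖` of `y ∈ N(τ) = Q(τ)X`. -/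
def normN (L : ℝ → ℝ → X →L[𝕜] X) (Q : ℝ → X →L[𝕜] X) (ρ τ : ℝ) (y : X) : ℝ :=
  ⨆ t : Iic τ, Real.exp (ρ * (t - τ)) * ‖backward L Q t τ y‖

/-- The norm `|y|_{S(τ)} = sup_{t ≥ τ} e^{γ(t - τ)} ‖L(t, τ) y‖` of `y ∈ S(τ) = (I - Q(τ))X`. -/
def normS (L : ℝ → ℝ → X →L[𝕜] X) (γ τ : ℝ) (y : X) : ℝ :=
  ⨆ t : Ici τ, Real.exp (γ * (t - τ)) * ‖L t τ y‖

/-- A norm `Γ` on `ℝ²` that is monotone in each variable on the closed first quadrant. -/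
structure IsAdmissibleNorm (Γ : ℝ × ℝ → ℝ) : Prop where
  add_le : ∀ a b : ℝ × ℝ, Γ (a + b) ≤ Γ a + Γ b
  smul : ∀ (c : ℝ) (a : ℝ × ℝ), Γ (c • a) = |c| * Γ a
  eq_zero : ∀ a : ℝ × ℝ, Γ a = 0 → a = 0
  mono_right : ∀ a : ℝ, 0 ≤ a → MonotoneOn (fun b => Γ (a, b)) (Ici 0)
  mono_left : ∀ b : ℝ, 0 ≤ b → MonotoneOn (fun a => Γ (a, b)) (Ici 0)

/-- The moving norm `‖x‖_τ = Γ(|Q(τ)x|_{N(τ)}, |(I - Q(τ))x|_{S(τ)})`. -/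
def movingNorm (L : ℝ → ℝ → X →L[𝕜] X) (Q : ℝ → X →L[𝕜] X) (γ ρ : ℝ) (Γ : ℝ × ℝ → ℝ)
    (τ : ℝ) (x : X) : ℝ :=
  Γ (normN L Q ρ τ (Q τ x), normS L γ τ (x - Q τ x))

/-- `f` is Lipschitz in the second variable, with constant `L₁` for its `N(t)` component
and constant `L₂` for its `S(t)` component. -/
def IsSplitLipschitz (L : ℝ → ℝ → X →L[𝕜] X) (Q : ℝ → X →L[𝕜] X) (γ ρ : ℝ) (Γ : ℝ × ℝ → ℝ)
    (f : ℝ → X → X) (L₁ L₂ : ℝ) : Prop :=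
  ∀ (t : ℝ) (u v : X),
    normN L Q ρ t (Q t (f t u - f t v)) ≤ L₁ * movingNorm L Q γ ρ Γ t (u - v) ∧
    normS L γ t ((f t u - f t v) - Q t (f t u - f t v)) ≤ L₂ * movingNorm L Q γ ρ Γ t (u - v)

/-- The variation of constants formula for `T`. -/
def SatisfiesVCF (L : ℝ → ℝ → X →L[𝕜] X) (f : ℝ → X → X) (T : ℝ → ℝ → X → X) : Prop :=
  ∀ τ t : ℝ, τ ≤ t → ∀ η : X,
    T t τ η = L t τ η + ∫ s in τ..t, L t s (f s (T s τ η))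

/-- `z` restricted to `(-∞, τ]` belongs to the space `E_{σ,τ}` of continuous functions with
`sup_{t ≤ τ} e^{σ(t - τ)} ‖z(t)‖_t < ∞`. -/
def MemE (L : ℝ → ℝ → X →L[𝕜] X) (Q : ℝ → X →L[𝕜] X) (γ ρ : ℝ) (Γ : ℝ × ℝ → ℝ)
    (σ τ : ℝ) (z : ℝ → X) : Prop :=
  ContinuousOn z (Iic τ) ∧
    BddAbove ((fun t => Real.exp (σ * (t - τ)) * movingNorm L Q γ ρ Γ t (z t)) '' Iic τ)

/-- The integrand `L(t, s)(I - Q(s)) f(s, z(s))`, for `s ≤ t`. -/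
def stableIntegrand (L : ℝ → ℝ → X →L[𝕜] X) (Q : ℝ → X →L[𝕜] X) (f : ℝ → X → X)
    (z : ℝ → X) (t s : ℝ) : X :=
  L t s (f s (z s) - Q s (f s (z s)))

/-- The map `H_{τ,η}`, with value at `z` the function
`t ↦ L(t,τ)Q(τ)η - ∫_t^τ L(t,s)Q(s)f(s,z(s))ds + ∫_{-∞}^t L(t,s)(I-Q(s))f(s,z(s))ds`, `t ≤ τ`. -/
def mapH (L : ℝ → ℝ → X →L[𝕜] X) (Q : ℝ → X →L[𝕜] X) (f : ℝ → X → X)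
    (τ : ℝ) (η : X) (z : ℝ → X) (t : ℝ) : X :=
  backward L Q t τ (Q τ η) - (∫ s in t..τ, backward L Q t s (Q s (f s (z s))))
    + ∫ s in Iic t, stableIntegrand L Q f z t s

/-- `z` restricted to `(-∞, τ]` is a fixed point of `H_{τ,η}` in `E_{σ,τ}`. -/
def IsFixedPointH (L : ℝ → ℝ → X →L[𝕜] X) (Q : ℝ → X →L[𝕜] X) (γ ρ : ℝ) (Γ : ℝ × ℝ → ℝ)
    (f : ℝ → X → X) (σ τ : ℝ) (η : X) (z : ℝ → X) : Prop :=
  MemE L Q γ ρ Γ σ τ z ∧ EqOn z (mapH L Q f τ η z) (Iic τ)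

/-- `z : ℝ → X` is a global solution (complete trajectory) of the process `T`. -/
def IsGlobalSolution (T : ℝ → ℝ → X → X) (z : ℝ → X) : Prop :=
  ∀ τ t : ℝ, τ ≤ t → T t τ (z τ) = z t

/-- The invariant manifold `𝓜(t)`: the points `z(t)` of global solutions `z` for which
`sup_{r ≤ t} e^{σ r} ‖z(r)‖_r < ∞`. -/
def manifold (L : ℝ → ℝ → X →L[𝕜] X) (Q : ℝ → X →L[𝕜] X) (γ ρ : ℝ) (Γ : ℝ × ℝ → ℝ)
    (T : ℝ → ℝ → X → X) (σ t : ℝ) : Set X :=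
  {η : X | ∃ z : ℝ → X, IsGlobalSolution T z ∧ z t = η ∧
    BddAbove ((fun r => Real.exp (σ * r) * movingNorm L Q γ ρ Γ r (z r)) '' Iic t)}

/-- `A` is the graph of a `C¹` map from the subspace `N` to the subspace `S`. -/
def IsC1Graph (N S : Submodule 𝕜 X) (A : Set X) : Prop :=
  ∃ g : N → S, ContDiff 𝕜 1 g ∧ A = range (fun n : N => (n : X) + (g n : X))

end InertialC1

end

/-! The backward trajectories that grow at most like `e^{-σt}` are the solutions of a
Lyapunov–Perron equation `z = L(·,τ)Q(τ)η + 𝒢(f(·,z))`. Here `𝒢` (`greenIntegral`) is the Green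
operator of the splitting: it integrates the stable part of the forcing from `-∞` and the unstable
part back from `τ`. In the moving norms the exponential bounds hold with constant one, so `𝒢` turns
forcing components of size `a` and `b` into a function of size `Γ(a/(σ-ρ), b/(γ-σ))`
(`movingNorm_greenIntegral_le`). The gap condition therefore says exactly that the equation is a
contraction. Existence is `exists_fixedPoint`; uniqueness, Lipschitz dependence on the datum and all
perturbation bounds come from one a priori estimate, `expBounded_of_forced`.

The fixed points describe the manifold. For a global solution `z` with the right growth, `z -
𝒢(f(·,z))` solves the homogeneous linear equation and grows too slowly at `-∞` to have a stable
part, so `z` solves the equation (`isMildSolution_of_isGlobalSolution`). Conversely a fixed point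
satisfies the variation of constants formula, hence follows `T` by Gronwall
(`forward_mildSolution`), and `T` extends it beyond `τ`.

For smoothness, the candidate derivative solves the linearised equation, with nonlinearity `u ↦
Df(s, z(s))u`. Difference quotients show that it inherits the split Lipschitz constants of `f`
(`isSplitNonlinearity_fderiv`), so the same contraction theory solves it. The obstacle is that the
remainder of the first-order expansion of `f(s,·)` is small for each `s` but not uniformly on `(-∞,
τ]`, so it need not be small in the norm of exponent `σ`. The gap condition is open, so it also
holds at some `σ' > σ` (`exists_larger`). A remainder dominated by `e^{-σ(s-τ)}` and tending to zero
pointwise tends to zero in the `L¹` norm with weight `e^{σ'(s-τ)}`, by dominated convergence, and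
`exists_forced_const` at exponent `σ'` converts this into smallness at time `τ`. The same device
gives differentiability (`hasFDerivAt_mildSolution`) and continuity of the derivative in operator
norm (`continuous_terminalValue`). -/

set_option linter.unusedSectionVars false

noncomputable section

namespace InertialC1

section

variable {𝕜 : Type*} [RCLike 𝕜]
variable {X : Type*} [NormedAddCommGroup X] [NormedSpace ℝ X] [NormedSpace 𝕜 X]

/-! ### Admissible norms on the plane -/

namespace IsAdmissibleNorm

variable {Γ : ℝ × ℝ → ℝ}

theorem zero (hΓ : IsAdmissibleNorm Γ) : Γ 0 = 0 := by
  simpa using hΓ.smul 0 0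

theorem nonneg (hΓ : IsAdmissibleNorm Γ) (a : ℝ × ℝ) : 0 ≤ Γ a := by
  have h := hΓ.add_le a ((-1 : ℝ) • a)
  rw [hΓ.smul] at h
  have h0 := hΓ.zero
  simp only [neg_smul, one_smul, add_neg_cancel, abs_neg, abs_one, one_mul] at h
  linarith

theorem mono (hΓ : IsAdmissibleNorm Γ) {a b c d : ℝ} (ha : 0 ≤ a) (hb : 0 ≤ b) (hac : a ≤ c)
    (hbd : b ≤ d) : Γ (a, b) ≤ Γ (c, d) :=
  (hΓ.mono_left b hb ha (ha.trans hac) hac).trans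
    (hΓ.mono_right c (ha.trans hac) hb (hb.trans hbd) hbd)

theorem scale (hΓ : IsAdmissibleNorm Γ) {c : ℝ} (hc : 0 ≤ c) (a b : ℝ) :
    Γ (c * a, c * b) = c * Γ (a, b) := by
  simpa [abs_of_nonneg hc] using hΓ.smul c (a, b)

theorem pos_left (hΓ : IsAdmissibleNorm Γ) : 0 < Γ (1, 0) :=
  lt_of_le_of_ne (hΓ.nonneg _) fun h => by simpa using hΓ.eq_zero _ h.symm

theorem pos_right (hΓ : IsAdmissibleNorm Γ) : 0 < Γ (0, 1) :=
  lt_of_le_of_ne (hΓ.nonneg _) fun h => by simpa using hΓ.eq_zero _ h.symm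

theorem le_upper (hΓ : IsAdmissibleNorm Γ) {a b : ℝ} (ha : 0 ≤ a) (hb : 0 ≤ b) :
    Γ (a, b) ≤ a * Γ (1, 0) + b * Γ (0, 1) := by
  have h := hΓ.add_le (a * 1, a * 0) (b * 0, b * 1)
  rw [hΓ.scale ha, hΓ.scale hb] at h
  simpa using h

theorem left_le (hΓ : IsAdmissibleNorm Γ) {a b : ℝ} (ha : 0 ≤ a) (hb : 0 ≤ b) :
    a * Γ (1, 0) ≤ Γ (a, b) := by
  rw [← hΓ.scale ha]
  exact hΓ.mono (by simpa) (by simp) (by simp) (by simpa)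

theorem right_le (hΓ : IsAdmissibleNorm Γ) {a b : ℝ} (ha : 0 ≤ a) (hb : 0 ≤ b) :
    b * Γ (0, 1) ≤ Γ (a, b) := by
  rw [← hΓ.scale hb]
  exact hΓ.mono (by simp) (by simpa) (by simpa) (by simp)

theorem add_le_lower (hΓ : IsAdmissibleNorm Γ) {a b : ℝ} (ha : 0 ≤ a) (hb : 0 ≤ b) :
    a + b ≤ ((Γ (1, 0))⁻¹ + (Γ (0, 1))⁻¹) * Γ (a, b) := by
  have h1 := hΓ.left_le ha hb
  have h2 := hΓ.right_le ha hb
  rw [← le_div_iff₀ hΓ.pos_left] at h1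
  rw [← le_div_iff₀ hΓ.pos_right] at h2
  calc a + b ≤ _ := add_le_add h1 h2
    _ = _ := by ring

end IsAdmissibleNorm

/-! ### Strongly continuous families of operators -/

theorem exists_bound_of_strong_continuousOn [CompleteSpace X] {α : Type*} [TopologicalSpace α]
    {A : α → X →L[𝕜] X} (hA : ∀ x, Continuous fun a => A a x) {K : Set α} (hK : IsCompact K) :
    ∃ C, 0 ≤ C ∧ ∀ a ∈ K, ‖A a‖ ≤ C := by
  have h : ∀ x, ∃ C, ∀ a : K, ‖A a x‖ ≤ C := fun x => by
    obtain ⟨C, hC⟩ := hK.exists_bound_of_continuousOn (hA x).continuousOn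
    exact ⟨C, fun a => hC a a.2⟩
  obtain ⟨C, hC⟩ := banach_steinhaus h
  exact ⟨max C 0, le_max_right _ _, fun a ha => (hC ⟨a, ha⟩).trans (le_max_left _ _)⟩

/-- Banach–Steinhaus bounds the operators uniformly near each parameter, which upgrades strong
continuity to joint continuity. The joint form is what makes `s ↦ A s (q s)` measurable for a merely
measurable `q`. -/
theorem continuous_clm_apply_of_strong [CompleteSpace X] {α : Type*} [TopologicalSpace α]
    [WeaklyLocallyCompactSpace α] {A : α → X →L[𝕜] X} (hA : ∀ x, Continuous fun a => A a x) :
    Continuous fun p : α × X => A p.1 p.2 := by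
  rw [continuous_iff_continuousAt]
  rintro ⟨a, x⟩
  obtain ⟨K, hK, hKa⟩ := exists_compact_mem_nhds a
  obtain ⟨C, hC0, hC⟩ := exists_bound_of_strong_continuousOn hA hK
  have h1 : Tendsto (fun p : α × X => C * ‖p.2 - x‖ + ‖A p.1 x - A a x‖) (𝓝 (a, x)) (𝓝 0) := by
    have : Continuous fun p : α × X => C * ‖p.2 - x‖ + ‖A p.1 x - A a x‖ := by
      have := (hA x).comp (continuous_fst (X := α) (Y := X))
      simp only [Function.comp_def] at this
      fun_prop
    simpa using this.tendsto (a, x)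
  rw [ContinuousAt, tendsto_iff_norm_sub_tendsto_zero]
  refine squeeze_zero' (Eventually.of_forall fun _ => norm_nonneg _) ?_ h1
  have hK' : ∀ᶠ p : α × X in 𝓝 (a, x), p.1 ∈ K := continuous_fst.continuousAt hKa
  filter_upwards [hK'] with p hp
  have : A p.1 p.2 - A a x = A p.1 (p.2 - x) + (A p.1 x - A a x) := by
    rw [map_sub]; abel
  rw [this]
  refine (norm_add_le _ _).trans (add_le_add_left ?_ _)
  exact ((A p.1).le_opNorm _).trans (mul_le_mul_of_nonneg_right (hC _ hp) (norm_nonneg _))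

/-! ### The backward and the stable operators -/

/-- The operator `L(t, s)Q(s)` for `t ≤ s`, as a continuous linear map. -/
def unstableOp (L : ℝ → ℝ → X →L[𝕜] X) (Q : ℝ → X →L[𝕜] X) (t s : ℝ) : X →L[𝕜] X :=
  open Classical in
  if h : ∃ A : X →L[𝕜] X, ∀ x, A x = backward L Q t s (Q s x) then h.choose else 0

/-- The operator `L(t, s)(I - Q(s))` for `s ≤ t`. -/
def stableOp (L : ℝ → ℝ → X →L[𝕜] X) (Q : ℝ → X →L[𝕜] X) (t s : ℝ) : X →L[𝕜] X :=
  (L t s).comp (ContinuousLinearMap.id 𝕜 X - Q s)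

@[simp]
theorem stableOp_apply (L : ℝ → ℝ → X →L[𝕜] X) (Q : ℝ → X →L[𝕜] X) (t s : ℝ) (x : X) :
    stableOp L Q t s x = L t s (x - Q s x) := by
  simp [stableOp]

variable {L : ℝ → ℝ → X →L[𝕜] X} {Q : ℝ → X →L[𝕜] X} {M γ ρ : ℝ}

theorem IsLinearEvolutionProcess.comp_apply (hL : IsLinearEvolutionProcess L) {τ s t : ℝ}
    (h1 : τ ≤ s) (h2 : s ≤ t) (x : X) : L t s (L s τ x) = L t τ x := by
  rw [hL.comp τ s t h1 h2]; rfl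

namespace HasExponentialSplitting

theorem M_pos (hs : HasExponentialSplitting L Q M γ ρ) : 0 < M := by linarith [hs.one_le]

theorem proj_apply (hs : HasExponentialSplitting L Q M γ ρ) (t : ℝ) (x : X) :
    Q t (Q t x) = Q t x :=
  congrArg (fun A : X →L[𝕜] X => A x) (hs.proj t)

theorem comm_apply (hs : HasExponentialSplitting L Q M γ ρ) {τ t : ℝ} (h : τ ≤ t) (x : X) :
    Q t (L t τ x) = L t τ (Q τ x) :=
  congrArg (fun A : X →L[𝕜] X => A x) (hs.comm τ t h)

theorem backward_mem (hs : HasExponentialSplitting L Q M γ ρ) {t s : ℝ} (h : t ≤ s) (x : X) :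
    backward L Q t s (Q s x) ∈ range (Q t) ∧ L s t (backward L Q t s (Q s x)) = Q s x :=
  Function.invFunOn_pos ((hs.iso t s h).surjOn (mem_range_self x))

theorem injective_of_proj (hs : HasExponentialSplitting L Q M γ ρ) {t s : ℝ} (h : t ≤ s)
    {x y : X} (hx : Q t x = x) (hy : Q t y = y) (hxy : L s t x = L s t y) : x = y :=
  (hs.iso t s h).injOn ⟨x, hx⟩ ⟨y, hy⟩ hxy

/-- `backward` is a chosen preimage, so its linearity is not automatic: it follows from injectivity
of `L s t` on the range of `Q t`. The unstable bound supplies continuity, so the operator in the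
definition of `unstableOp` exists. -/
theorem unstableOp_apply (hs : HasExponentialSplitting L Q M γ ρ) {t s : ℝ} (h : t ≤ s) (x : X) :
    unstableOp L Q t s x = backward L Q t s (Q s x) := by
  have key : ∃ A : X →L[𝕜] X, ∀ x, A x = backward L Q t s (Q s x) := by
    have hp : ∀ x, Q t (backward L Q t s (Q s x)) = backward L Q t s (Q s x) := fun x => by
      obtain ⟨y, hy⟩ := (hs.backward_mem h x).1
      rw [← hy, hs.proj_apply]
    have hl := fun x => (hs.backward_mem h x).2
    refine ⟨LinearMap.mkContinuous
      { toFun := fun x => backward L Q t s (Q s x)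
        map_add' := fun x y => hs.injective_of_proj h (hp _) (by rw [map_add, hp, hp])
          (by rw [hl, map_add, map_add, hl, hl])
        map_smul' := fun c x => hs.injective_of_proj h (hp _) (by simp [hp])
          (by
            rw [hl, map_smul]
            simp only [RingHom.id_apply]
            rw [map_smul, hl]) }
      (Real.exp (-(ρ * (t - s))) * M) fun x => ?_, fun x => rfl⟩
    have := hs.unstable s t h x
    rw [Real.exp_neg, mul_assoc, inv_mul_eq_div, le_div_iff₀ (Real.exp_pos _), mul_comm]
    exact this
  rw [unstableOp, dif_pos key]
  exact key.choose_spec x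

theorem proj_unstableOp (hs : HasExponentialSplitting L Q M γ ρ) {t s : ℝ} (h : t ≤ s) (x : X) :
    Q t (unstableOp L Q t s x) = unstableOp L Q t s x := by
  obtain ⟨y, hy⟩ := (hs.backward_mem h x).1
  rw [hs.unstableOp_apply h, ← hy, hs.proj_apply]

theorem forward_unstableOp (hs : HasExponentialSplitting L Q M γ ρ) {t s : ℝ} (h : t ≤ s)
    (x : X) : L s t (unstableOp L Q t s x) = Q s x := by
  rw [hs.unstableOp_apply h, (hs.backward_mem h x).2]

/-- The characterisation from which the algebra below follows: a vector of the unstable space is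
determined by its forward image. -/
theorem eq_unstableOp (hs : HasExponentialSplitting L Q M γ ρ) {t s : ℝ} (h : t ≤ s) {x y : X}
    (hy : Q t y = y) (hxy : L s t y = Q s x) : y = unstableOp L Q t s x :=
  hs.injective_of_proj h hy (hs.proj_unstableOp h x) (by rw [hxy, hs.forward_unstableOp h])

theorem unstableOp_self (hL : IsLinearEvolutionProcess L)
    (hs : HasExponentialSplitting L Q M γ ρ) (t : ℝ) (x : X) : unstableOp L Q t t x = Q t x :=
  (hs.eq_unstableOp le_rfl (hs.proj_apply t x) (by simp [hL.refl])).symm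

theorem unstableOp_proj (hs : HasExponentialSplitting L Q M γ ρ) {t s : ℝ} (h : t ≤ s) (x : X) :
    unstableOp L Q t s (Q s x) = unstableOp L Q t s x :=
  hs.eq_unstableOp h (hs.proj_unstableOp h _) (by rw [hs.forward_unstableOp h, hs.proj_apply])

theorem unstableOp_comp (hL : IsLinearEvolutionProcess L)
    (hs : HasExponentialSplitting L Q M γ ρ) {r t s : ℝ} (h1 : r ≤ t) (h2 : t ≤ s) (x : X) :
    unstableOp L Q r t (unstableOp L Q t s x) = unstableOp L Q r s x :=
  hs.eq_unstableOp (h1.trans h2) (hs.proj_unstableOp h1 _) (by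
    rw [← hL.comp_apply h1 h2, hs.forward_unstableOp h1, hs.proj_unstableOp h2,
      hs.forward_unstableOp h2])

/-- Moving forward along a backward solution. -/
theorem forward_unstableOp_of_le (hL : IsLinearEvolutionProcess L)
    (hs : HasExponentialSplitting L Q M γ ρ) {r t s : ℝ} (h1 : r ≤ t) (h2 : t ≤ s) (x : X) :
    L t r (unstableOp L Q r s x) = unstableOp L Q t s x := by
  rw [← hs.unstableOp_comp hL h1 h2, hs.forward_unstableOp h1, hs.proj_unstableOp h2]

/-- Going forward from `s` to `r` and then back to `t ≤ s`. -/
theorem unstableOp_forward (hL : IsLinearEvolutionProcess L)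
    (hs : HasExponentialSplitting L Q M γ ρ) {t s r : ℝ} (h1 : t ≤ s) (h2 : s ≤ r) (x : X) :
    unstableOp L Q t r (L r s x) = unstableOp L Q t s x :=
  (hs.eq_unstableOp (h1.trans h2) (hs.proj_unstableOp h1 _) (by
    rw [← hL.comp_apply h1 h2, hs.forward_unstableOp h1, hs.comm_apply h2])).symm

theorem norm_unstableOp_apply_le (hs : HasExponentialSplitting L Q M γ ρ) {t s : ℝ} (h : t ≤ s)
    (x : X) : ‖unstableOp L Q t s x‖ ≤ M * Real.exp (-(ρ * (t - s))) * ‖x‖ := by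
  have := hs.unstable s t h x
  rw [hs.unstableOp_apply h, Real.exp_neg, mul_right_comm, ← div_eq_mul_inv,
    le_div_iff₀ (Real.exp_pos _), mul_comm]
  exact this

theorem norm_stableOp_apply_le (hs : HasExponentialSplitting L Q M γ ρ) {t s : ℝ} (h : s ≤ t)
    (x : X) : ‖stableOp L Q t s x‖ ≤ M * Real.exp (-(γ * (t - s))) * ‖x‖ := by
  have := hs.stable s t h
  refine ((stableOp L Q t s).le_opNorm x).trans (mul_le_mul_of_nonneg_right ?_ (norm_nonneg x))
  rw [Real.exp_neg, ← div_eq_mul_inv, le_div_iff₀ (Real.exp_pos _), mul_comm]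
  exact this

/-- The stable part is propagated by the process. -/
theorem forward_stableOp (hL : IsLinearEvolutionProcess L) {s t r : ℝ} (h1 : s ≤ t) (h2 : t ≤ r)
    (x : X) : L r t (stableOp L Q t s x) = stableOp L Q r s x := by
  rw [stableOp_apply, stableOp_apply, hL.comp_apply h1 h2]

theorem proj_stableOp (hs : HasExponentialSplitting L Q M γ ρ) {s t : ℝ} (h : s ≤ t) (x : X) :
    Q t (stableOp L Q t s x) = 0 := by
  rw [stableOp_apply, hs.comm_apply h, map_sub, hs.proj_apply, sub_self, map_zero]

theorem stableOp_comp (hL : IsLinearEvolutionProcess L)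
    (hs : HasExponentialSplitting L Q M γ ρ) {s t r : ℝ} (h1 : s ≤ t) (h2 : t ≤ r) (x : X) :
    stableOp L Q r t (stableOp L Q t s x) = stableOp L Q r s x := by
  rw [stableOp_apply L Q r t, hs.proj_stableOp h1, sub_zero, forward_stableOp hL h1 h2]

theorem stableOp_unstableOp (hs : HasExponentialSplitting L Q M γ ρ) {t s : ℝ} (h : t ≤ s)
    (r : ℝ) (x : X) : stableOp L Q r t (unstableOp L Q t s x) = 0 := by
  rw [stableOp_apply, hs.proj_unstableOp h, sub_self, map_zero]

theorem unstableOp_stableOp (hs : HasExponentialSplitting L Q M γ ρ) {r t s : ℝ} (h1 : r ≤ t)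
    (h2 : s ≤ t) (x : X) : unstableOp L Q r t (stableOp L Q t s x) = 0 := by
  rw [← hs.unstableOp_proj h1, hs.proj_stableOp h2, map_zero]

/-! ### Strong continuity -/

/-- Ordering the two times by `max` and `min` gives a family defined on the whole plane, so values
of `L` at misordered times never enter. -/
theorem _root_.InertialC1.IsLinearEvolutionProcess.continuous_forward [CompleteSpace X]
    (hL : IsLinearEvolutionProcess L) :
    Continuous fun p : (ℝ × ℝ) × X => L (max p.1.1 p.1.2) (min p.1.1 p.1.2) p.2 := by
  refine continuous_clm_apply_of_strong (A := fun p : ℝ × ℝ => L (max p.1 p.2) (min p.1 p.2))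
    fun x => ?_
  have := (hL.cont x).comp_continuous (f := fun p : ℝ × ℝ => (max p.1 p.2, min p.1 p.2))
    (by fun_prop) (fun p => show min p.1 p.2 ≤ max p.1 p.2 from min_le_max)
  exact this

/-- For `s ≤ s'` the operators at `s` and `s'` differ by `unstableOp L Q t s'` applied to `L s' s x
- x`, so strong continuity of the process is enough. -/
theorem continuous_unstableOp_right [CompleteSpace X] (hL : IsLinearEvolutionProcess L)
    (hs : HasExponentialSplitting L Q M γ ρ) (t : ℝ) :
    Continuous fun p : ℝ × X => unstableOp L Q t (max t p.1) p.2 := by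
  refine continuous_clm_apply_of_strong (A := fun s => unstableOp L Q t (max t s)) fun x => ?_
  rw [continuous_iff_continuousAt]
  intro s₀
  rw [ContinuousAt, tendsto_iff_norm_sub_tendsto_zero]
  set a : ℝ → ℝ := fun s => max t s with ha
  have hac : Continuous a := by fun_prop
  have hta : ∀ s, t ≤ a s := fun s => le_max_left _ _
  have hdiff : ∀ s s' : ℝ, t ≤ s → s ≤ s' →
      ‖unstableOp L Q t s x - unstableOp L Q t s' x‖ ≤
        M * Real.exp (-(ρ * (t - s'))) * ‖L s' s x - x‖ := fun s s' h h' => by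
    rw [← hs.unstableOp_forward hL h h' x, ← map_sub]
    exact hs.norm_unstableOp_apply_le (h.trans h') _
  have hlim : Tendsto (fun s => M * Real.exp (-(ρ * (t - max (a s) (a s₀)))) *
      ‖L (max (a s) (a s₀)) (min (a s) (a s₀)) x - x‖) (𝓝 s₀) (𝓝 0) := by
    have h1 : Continuous fun s => L (max (a s) (a s₀)) (min (a s) (a s₀)) x :=
      hL.continuous_forward.comp (f := fun s => ((a s, a s₀), x)) (by fun_prop)
    have h2 : Continuous fun s => M * Real.exp (-(ρ * (t - max (a s) (a s₀)))) *
      ‖L (max (a s) (a s₀)) (min (a s) (a s₀)) x - x‖ :=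
      (show Continuous fun s => M * Real.exp (-(ρ * (t - max (a s) (a s₀)))) by fun_prop).mul
        (h1.sub continuous_const).norm
    simpa [hL.refl] using h2.tendsto s₀
  refine squeeze_zero (fun _ => norm_nonneg _) (fun s => ?_) hlim
  rcases le_total (a s) (a s₀) with h | h
  · rw [max_eq_right h, min_eq_left h]
    exact hdiff _ _ (hta s) h
  · rw [max_eq_left h, min_eq_right h, norm_sub_rev]
    exact hdiff _ _ (hta s₀) h

theorem continuousOn_unstableOp_left [CompleteSpace X] (hL : IsLinearEvolutionProcess L)
    (hs : HasExponentialSplitting L Q M γ ρ) (s : ℝ) (x : X) :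
    ContinuousOn (fun t => unstableOp L Q t s x) (Iic s) := by
  intro t₀ ht₀
  -- Near `t₀` the backward orbit is the forward orbit of its own value at `t₀ - 1`.
  have h : ContinuousOn (fun t => L t (t₀ - 1) (unstableOp L Q (t₀ - 1) s x)) (Ici (t₀ - 1)) :=
    (hL.cont _).comp (f := fun t => (t, t₀ - 1)) (by fun_prop) fun t ht => ht
  have h' : ContinuousAt (fun t => L t (t₀ - 1) (unstableOp L Q (t₀ - 1) s x)) t₀ :=
    h.continuousAt (Ici_mem_nhds (by linarith))
  refine h'.continuousWithinAt.congr_of_eventuallyEq ?_ ?_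
  · have : ∀ᶠ t in 𝓝[Iic s] t₀, t₀ - 1 ≤ t :=
      mem_nhdsWithin_of_mem_nhds (Ici_mem_nhds (by linarith))
    filter_upwards [this, self_mem_nhdsWithin] with t h1 h2
    exact (hs.forward_unstableOp_of_le hL h1 h2 x).symm
  · exact (hs.forward_unstableOp_of_le hL (by linarith) ht₀ x).symm

/-- No continuity of `Q` is assumed. It follows from the factorisation of `Q s` as going back from
`s` to `s₀ - 1` and forward again. -/
theorem continuous_proj [CompleteSpace X] (hL : IsLinearEvolutionProcess L)
    (hs : HasExponentialSplitting L Q M γ ρ) : Continuous fun p : ℝ × X => Q p.1 p.2 := by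
  refine continuous_clm_apply_of_strong fun x => ?_
  rw [continuous_iff_continuousAt]
  intro s₀
  have h : Continuous fun s => L (max s (s₀ - 1)) (min s (s₀ - 1))
      (unstableOp L Q (s₀ - 1) (max (s₀ - 1) s) x) :=
    hL.continuous_forward.comp
      (f := fun s => ((s, s₀ - 1), unstableOp L Q (s₀ - 1) (max (s₀ - 1) s) x))
      (by
        have := (hs.continuous_unstableOp_right hL (s₀ - 1)).comp
          (f := fun s : ℝ => (s, x)) (by fun_prop)
        simp only [Function.comp_def] at this
        fun_prop)
  refine h.continuousAt.congr ?_
  filter_upwards [Ici_mem_nhds (show s₀ - 1 < s₀ by linarith)] with s hs'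
  rw [max_eq_left hs', min_eq_right hs', max_eq_right hs', hs.forward_unstableOp hs']

theorem continuous_stableOp_right [CompleteSpace X] (hL : IsLinearEvolutionProcess L)
    (hs : HasExponentialSplitting L Q M γ ρ) (t : ℝ) :
    Continuous fun p : ℝ × X => stableOp L Q t (min p.1 t) p.2 := by
  have h1 : Continuous fun p : ℝ × X => p.2 - Q (min p.1 t) p.2 :=
    continuous_snd.sub
      ((hs.continuous_proj hL).comp (f := fun p : ℝ × X => (min p.1 t, p.2)) (by fun_prop))
  have h2 := hL.continuous_forward.comp
    (f := fun p : ℝ × X => ((t, min p.1 t), p.2 - Q (min p.1 t) p.2)) (by fun_prop)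
  refine h2.congr fun p => ?_
  simp only [Function.comp_def, stableOp_apply]
  rw [max_eq_left (min_le_right _ _), min_eq_right (min_le_right _ _)]

theorem continuousOn_stableOp_left (hL : IsLinearEvolutionProcess L) (s : ℝ) (x : X) :
    ContinuousOn (fun t => stableOp L Q t s x) (Ici s) := by
  simp only [stableOp_apply]
  exact (hL.cont _).comp (f := fun t => (t, s)) (by fun_prop) fun t ht => ht

end HasExponentialSplitting

end

section

variable {𝕜 : Type*} [RCLike 𝕜]
variable {X : Type*} [NormedAddCommGroup X] [NormedSpace ℝ X] [NormedSpace 𝕜 X]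
variable {L : ℝ → ℝ → X →L[𝕜] X} {Q : ℝ → X →L[𝕜] X} {M γ ρ : ℝ} {Γ : ℝ × ℝ → ℝ}

/-! ### The moving norms -/

/-- The seminorm `x ↦ |Q(τ)x|_{N(τ)}` on `X`. -/
def unstableNorm (L : ℝ → ℝ → X →L[𝕜] X) (Q : ℝ → X →L[𝕜] X) (ρ τ : ℝ) (x : X) : ℝ :=
  normN L Q ρ τ (Q τ x)

/-- The seminorm `x ↦ |(I - Q(τ))x|_{S(τ)}` on `X`. -/
def stableNorm (L : ℝ → ℝ → X →L[𝕜] X) (Q : ℝ → X →L[𝕜] X) (γ τ : ℝ) (x : X) : ℝ :=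
  normS L γ τ (x - Q τ x)

namespace HasExponentialSplitting

/-- The splitting bound makes the supremum finite; an unbounded real `⨆` would take the default
value `0` and the equivalence would fail. -/
theorem unstableNorm_le_iff (hs : HasExponentialSplitting L Q M γ ρ) {τ c : ℝ} {x : X} :
    unstableNorm L Q ρ τ x ≤ c ↔
      ∀ r ≤ τ, Real.exp (ρ * (r - τ)) * ‖unstableOp L Q r τ x‖ ≤ c := by
  have hb : BddAbove (range fun t : Iic τ =>
      Real.exp (ρ * (t - τ)) * ‖backward L Q t τ (Q τ x)‖) := by
    refine ⟨M * ‖x‖, ?_⟩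
    rintro _ ⟨t, rfl⟩
    exact hs.unstable τ t t.2 x
  unfold unstableNorm normN
  rw [ciSup_le_iff hb]
  constructor
  · intro h r hr
    rw [hs.unstableOp_apply hr]
    exact h ⟨r, hr⟩
  · rintro h ⟨r, hr⟩
    have := h r hr
    rwa [hs.unstableOp_apply hr] at this

theorem stableNorm_le_iff (hs : HasExponentialSplitting L Q M γ ρ) {τ c : ℝ} {x : X} :
    stableNorm L Q γ τ x ≤ c ↔
      ∀ r, τ ≤ r → Real.exp (γ * (r - τ)) * ‖stableOp L Q r τ x‖ ≤ c := by
  have hb : BddAbove (range fun t : Ici τ =>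
      Real.exp (γ * (t - τ)) * ‖L t τ (x - Q τ x)‖) := by
    refine ⟨M * ‖x‖, ?_⟩
    rintro _ ⟨t, rfl⟩
    have := hs.norm_stableOp_apply_le t.2 x
    rw [Real.exp_neg, mul_right_comm, ← div_eq_mul_inv, le_div_iff₀ (Real.exp_pos _), mul_comm,
      stableOp_apply] at this
    exact this
  unfold stableNorm normS
  rw [ciSup_le_iff hb]
  constructor
  · intro h r hr
    rw [stableOp_apply]
    exact h ⟨r, hr⟩
  · rintro h ⟨r, hr⟩
    have := h r hr
    rwa [stableOp_apply] at this

theorem norm_unstableOp_le_unstableNorm (hs : HasExponentialSplitting L Q M γ ρ) {r τ : ℝ}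
    (h : r ≤ τ) (x : X) :
    ‖unstableOp L Q r τ x‖ ≤ Real.exp (-(ρ * (r - τ))) * unstableNorm L Q ρ τ x := by
  have := hs.unstableNorm_le_iff.1 (le_refl (unstableNorm L Q ρ τ x)) r h
  rwa [Real.exp_neg, inv_mul_eq_div, le_div_iff₀ (Real.exp_pos _), mul_comm]

theorem norm_stableOp_le_stableNorm (hs : HasExponentialSplitting L Q M γ ρ) {r τ : ℝ}
    (h : τ ≤ r) (x : X) :
    ‖stableOp L Q r τ x‖ ≤ Real.exp (-(γ * (r - τ))) * stableNorm L Q γ τ x := by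
  have := hs.stableNorm_le_iff.1 (le_refl (stableNorm L Q γ τ x)) r h
  rwa [Real.exp_neg, inv_mul_eq_div, le_div_iff₀ (Real.exp_pos _), mul_comm]

theorem unstableNorm_nonneg (hs : HasExponentialSplitting L Q M γ ρ) (τ : ℝ) (x : X) :
    0 ≤ unstableNorm L Q ρ τ x :=
  le_trans (by positivity) (hs.unstableNorm_le_iff.1 le_rfl τ le_rfl)

theorem stableNorm_nonneg (hs : HasExponentialSplitting L Q M γ ρ) (τ : ℝ) (x : X) :
    0 ≤ stableNorm L Q γ τ x :=
  le_trans (by positivity) (hs.stableNorm_le_iff.1 le_rfl τ le_rfl)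

theorem unstableNorm_add_le (hs : HasExponentialSplitting L Q M γ ρ) (τ : ℝ) (x y : X) :
    unstableNorm L Q ρ τ (x + y) ≤ unstableNorm L Q ρ τ x + unstableNorm L Q ρ τ y := by
  refine hs.unstableNorm_le_iff.2 fun r hr => ?_
  refine le_trans ?_ (add_le_add (hs.unstableNorm_le_iff.1 le_rfl r hr)
    (hs.unstableNorm_le_iff.1 le_rfl r hr))
  rw [map_add, ← mul_add]
  exact mul_le_mul_of_nonneg_left (norm_add_le _ _) (Real.exp_pos _).le

theorem stableNorm_add_le (hs : HasExponentialSplitting L Q M γ ρ) (τ : ℝ) (x y : X) :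
    stableNorm L Q γ τ (x + y) ≤ stableNorm L Q γ τ x + stableNorm L Q γ τ y := by
  refine hs.stableNorm_le_iff.2 fun r hr => ?_
  refine le_trans ?_ (add_le_add (hs.stableNorm_le_iff.1 le_rfl r hr)
    (hs.stableNorm_le_iff.1 le_rfl r hr))
  rw [map_add, ← mul_add]
  exact mul_le_mul_of_nonneg_left (norm_add_le _ _) (Real.exp_pos _).le

theorem unstableNorm_smul_le (hs : HasExponentialSplitting L Q M γ ρ) (τ : ℝ) (c : 𝕜) (x : X) :
    unstableNorm L Q ρ τ (c • x) ≤ ‖c‖ * unstableNorm L Q ρ τ x := by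
  refine hs.unstableNorm_le_iff.2 fun r hr => ?_
  rw [map_smul, norm_smul, mul_left_comm]
  exact mul_le_mul_of_nonneg_left (hs.unstableNorm_le_iff.1 le_rfl r hr) (norm_nonneg _)

theorem stableNorm_smul_le (hs : HasExponentialSplitting L Q M γ ρ) (τ : ℝ) (c : 𝕜) (x : X) :
    stableNorm L Q γ τ (c • x) ≤ ‖c‖ * stableNorm L Q γ τ x := by
  refine hs.stableNorm_le_iff.2 fun r hr => ?_
  rw [map_smul, norm_smul, mul_left_comm]
  exact mul_le_mul_of_nonneg_left (hs.stableNorm_le_iff.1 le_rfl r hr) (norm_nonneg _)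

theorem unstableNorm_le_norm (hs : HasExponentialSplitting L Q M γ ρ) (τ : ℝ) (x : X) :
    unstableNorm L Q ρ τ x ≤ M * ‖x‖ :=
  hs.unstableNorm_le_iff.2 fun r hr => by
    rw [hs.unstableOp_apply hr]; exact hs.unstable τ r hr x

theorem stableNorm_le_norm (hs : HasExponentialSplitting L Q M γ ρ) (τ : ℝ) (x : X) :
    stableNorm L Q γ τ x ≤ M * ‖x‖ :=
  hs.stableNorm_le_iff.2 fun r hr => by
    have := hs.norm_stableOp_apply_le hr x
    rwa [Real.exp_neg, mul_right_comm, ← div_eq_mul_inv, le_div_iff₀ (Real.exp_pos _),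
      mul_comm] at this

theorem norm_le_unstableNorm_add (hL : IsLinearEvolutionProcess L)
    (hs : HasExponentialSplitting L Q M γ ρ) (τ : ℝ) (x : X) :
    ‖x‖ ≤ unstableNorm L Q ρ τ x + stableNorm L Q γ τ x := by
  have h1 := hs.norm_unstableOp_le_unstableNorm (le_refl τ) x
  have h2 := hs.norm_stableOp_le_stableNorm (le_refl τ) x
  rw [hs.unstableOp_self hL] at h1
  simp only [sub_self, mul_zero, neg_zero, Real.exp_zero, one_mul, stableOp_apply, hL.refl,
    ContinuousLinearMap.id_apply] at h1 h2
  calc ‖x‖ = ‖Q τ x + (x - Q τ x)‖ := by congr 1; abel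
    _ ≤ _ := (norm_add_le _ _).trans (add_le_add h1 h2)

theorem movingNorm_le (hs : HasExponentialSplitting L Q M γ ρ) (hΓ : IsAdmissibleNorm Γ)
    {τ a b : ℝ} {x : X} (ha : unstableNorm L Q ρ τ x ≤ a) (hb : stableNorm L Q γ τ x ≤ b) :
    movingNorm L Q γ ρ Γ τ x ≤ Γ (a, b) :=
  hΓ.mono (hs.unstableNorm_nonneg τ x) (hs.stableNorm_nonneg τ x) ha hb

theorem movingNorm_add_le (hs : HasExponentialSplitting L Q M γ ρ) (hΓ : IsAdmissibleNorm Γ)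
    (τ : ℝ) (x y : X) : movingNorm L Q γ ρ Γ τ (x + y) ≤
      movingNorm L Q γ ρ Γ τ x + movingNorm L Q γ ρ Γ τ y :=
  (hs.movingNorm_le hΓ (hs.unstableNorm_add_le τ x y) (hs.stableNorm_add_le τ x y)).trans
    (hΓ.add_le (_, _) (_, _))

theorem movingNorm_smul_le (hs : HasExponentialSplitting L Q M γ ρ) (hΓ : IsAdmissibleNorm Γ)
    (τ : ℝ) (c : 𝕜) (x : X) : movingNorm L Q γ ρ Γ τ (c • x) ≤
      ‖c‖ * movingNorm L Q γ ρ Γ τ x :=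
  (hs.movingNorm_le hΓ (hs.unstableNorm_smul_le τ c x) (hs.stableNorm_smul_le τ c x)).trans
    (hΓ.scale (norm_nonneg c) _ _).le

theorem movingNorm_sub_le (hs : HasExponentialSplitting L Q M γ ρ) (hΓ : IsAdmissibleNorm Γ)
    (τ : ℝ) (x y : X) : movingNorm L Q γ ρ Γ τ (x - y) ≤
      movingNorm L Q γ ρ Γ τ x + movingNorm L Q γ ρ Γ τ y := by
  have h := hs.movingNorm_smul_le hΓ τ (-1) y
  have h' := hs.movingNorm_add_le hΓ τ x ((-1 : 𝕜) • y)
  simp only [neg_smul, one_smul, norm_neg, norm_one, one_mul, ← sub_eq_add_neg] at h h'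
  linarith

/-- The moving norms are uniformly equivalent to the norm of `X`. -/
theorem exists_movingNorm_equiv (hL : IsLinearEvolutionProcess L)
    (hs : HasExponentialSplitting L Q M γ ρ) (hΓ : IsAdmissibleNorm Γ) :
    ∃ c, 0 < c ∧ (∀ τ x, ‖x‖ ≤ c * movingNorm L Q γ ρ Γ τ x) ∧
      ∀ τ x, movingNorm L Q γ ρ Γ τ x ≤ c * ‖x‖ := by
  have hl := hΓ.pos_left
  have hr := hΓ.pos_right
  have hM := hs.M_pos
  refine ⟨((Γ (1, 0))⁻¹ + (Γ (0, 1))⁻¹) + M * (Γ (1, 0) + Γ (0, 1)), by positivity,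
    fun τ x => ?_, fun τ x => ?_⟩
  · refine (hs.norm_le_unstableNorm_add hL τ x).trans ?_
    refine (hΓ.add_le_lower (hs.unstableNorm_nonneg τ x) (hs.stableNorm_nonneg τ x)).trans ?_
    refine mul_le_mul_of_nonneg_right ?_ (hΓ.nonneg _)
    have : 0 ≤ M * (Γ (1, 0) + Γ (0, 1)) := by positivity
    linarith
  · have h0 : 0 ≤ M * ‖x‖ := by positivity
    refine (hs.movingNorm_le hΓ (hs.unstableNorm_le_norm τ x) (hs.stableNorm_le_norm τ x)).trans ?_
    refine (hΓ.le_upper h0 h0).trans ?_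
    have : 0 ≤ ((Γ (1, 0))⁻¹ + (Γ (0, 1))⁻¹) * ‖x‖ := by positivity
    nlinarith

theorem movingNorm_zero (hΓ : IsAdmissibleNorm Γ) (hs : HasExponentialSplitting L Q M γ ρ)
    (τ : ℝ) : movingNorm L Q γ ρ Γ τ 0 = 0 := by
  have h := hs.movingNorm_smul_le hΓ τ 0 0
  rw [zero_smul, norm_zero, zero_mul] at h
  exact le_antisymm h (hΓ.nonneg _)

end HasExponentialSplitting

/-! ### The Green operator -/

/-- The Green operator: `L(t, s)(I - Q(s))` for `s ≤ t` and `-L(t, s)Q(s)` for `s > t`. -/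
def greenOp (L : ℝ → ℝ → X →L[𝕜] X) (Q : ℝ → X →L[𝕜] X) (t s : ℝ) : X →L[𝕜] X :=
  if s ≤ t then stableOp L Q t s else -unstableOp L Q t s

/-- The bounded solution of the inhomogeneous linear equation on `(-∞, τ]` whose unstable
component vanishes at `τ`. -/
def greenIntegral (L : ℝ → ℝ → X →L[𝕜] X) (Q : ℝ → X →L[𝕜] X) (τ : ℝ) (q : ℝ → X) (t : ℝ) : X :=
  ∫ s in Iic τ, greenOp L Q t s (q s)

/-- Integrability of `q` on `(-∞, τ]` with respect to the weight `e^{σ(s - τ)}`. -/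
structure WeightedIntegrable (σ τ : ℝ) (q : ℝ → X) : Prop where
  aesm : AEStronglyMeasurable q (volume.restrict (Iic τ))
  int : IntegrableOn (fun s => Real.exp (σ * (s - τ)) * ‖q s‖) (Iic τ)

theorem WeightedIntegrable.add {σ τ : ℝ} {q p : ℝ → X} (hq : WeightedIntegrable σ τ q)
    (hp : WeightedIntegrable σ τ p) : WeightedIntegrable σ τ fun s => q s + p s where
  aesm := hq.aesm.add hp.aesm
  int := by
    refine (hq.int.add hp.int).mono' ?_ (Eventually.of_forall fun s => ?_)
    · exact (show Continuous fun s => Real.exp (σ * (s - τ)) by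
        fun_prop).aestronglyMeasurable.mul (hq.aesm.add hp.aesm).norm
    · rw [Real.norm_of_nonneg (by positivity), Pi.add_apply, ← mul_add]
      exact mul_le_mul_of_nonneg_left (norm_add_le _ _) (Real.exp_pos _).le

theorem WeightedIntegrable.smul {σ τ : ℝ} {q : ℝ → X} (hq : WeightedIntegrable σ τ q) (c : 𝕜) :
    WeightedIntegrable σ τ fun s => c • q s where
  aesm := hq.aesm.const_smul c
  int := by
    refine (hq.int.const_mul ‖c‖).congr (Eventually.of_forall fun s => ?_)
    simp only [norm_smul]
    ring

/-- At exponent `σ` itself the weighted norm is only bounded. A strictly larger exponent leaves the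
integrable factor `e^{(σ'-σ)(s-τ)}`. -/
theorem weightedIntegrable_of_norm_le {σ σ' τ C : ℝ} (hσ : σ < σ') {q : ℝ → X}
    (hq : AEStronglyMeasurable q (volume.restrict (Iic τ)))
    (hb : ∀ s ≤ τ, ‖q s‖ ≤ C * Real.exp (-(σ * (s - τ)))) : WeightedIntegrable σ' τ q where
  aesm := hq
  int := by
    have h := ((integrableOn_exp_mul_Iic (show 0 < σ' - σ by linarith) τ).const_mul
      (C * Real.exp (-((σ' - σ) * τ))))
    refine h.mono' ?_ ?_
    · exact (show Continuous fun s => Real.exp (σ' * (s - τ)) by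
        fun_prop).aestronglyMeasurable.mul hq.norm
    · refine (ae_restrict_iff' measurableSet_Iic).2 (Eventually.of_forall fun s hs => ?_)
      rw [Real.norm_of_nonneg (by positivity)]
      calc Real.exp (σ' * (s - τ)) * ‖q s‖
          ≤ Real.exp (σ' * (s - τ)) * (C * Real.exp (-(σ * (s - τ)))) :=
            mul_le_mul_of_nonneg_left (hb s hs) (Real.exp_pos _).le
        _ = C * Real.exp (σ' * (s - τ) + -(σ * (s - τ))) := by rw [Real.exp_add]; ring
        _ = C * Real.exp (-((σ' - σ) * τ) + (σ' - σ) * s) := by congr 2; ring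
        _ = _ := by rw [Real.exp_add]; ring

namespace HasExponentialSplitting

variable {σ τ : ℝ}

/-- Both branches of the kernel are bounded by `M e^{-σ(t-s)}`: the stable one because `σ ≤ γ` and
`t ≥ s`, the unstable one because `ρ ≤ σ` and `t < s`. Splitting the exponent at `τ` separates `t`
from `s`. -/
theorem norm_greenOp_apply_le (hs : HasExponentialSplitting L Q M γ ρ) (hρσ : ρ ≤ σ)
    (hσγ : σ ≤ γ) (t s τ : ℝ) (x : X) : ‖greenOp L Q t s x‖ ≤
      M * Real.exp (-(σ * (t - τ))) * (Real.exp (σ * (s - τ)) * ‖x‖) := by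
  have hM := hs.M_pos
  have key : ‖greenOp L Q t s x‖ ≤ M * Real.exp (-(σ * (t - s))) * ‖x‖ := by
    unfold greenOp
    split_ifs with h
    · refine (hs.norm_stableOp_apply_le h x).trans ?_
      gcongr
    · push Not at h
      rw [neg_apply, norm_neg]
      refine (hs.norm_unstableOp_apply_le h.le x).trans ?_
      gcongr ?_ * Real.exp ?_ * _
      nlinarith
  refine key.trans (le_of_eq ?_)
  rw [mul_assoc, mul_assoc, ← mul_assoc (Real.exp _) (Real.exp _), ← Real.exp_add]
  congr 3
  ring

theorem aestronglyMeasurable_stableOp [CompleteSpace X] (hL : IsLinearEvolutionProcess L)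
    (hs : HasExponentialSplitting L Q M γ ρ) {μ : Measure ℝ} {q : ℝ → X}
    (hq : AEStronglyMeasurable q μ) (t : ℝ) :
    AEStronglyMeasurable (fun s => stableOp L Q t (min s t) (q s)) μ :=
  (hs.continuous_stableOp_right hL t).comp_aestronglyMeasurable
    (continuous_id.aestronglyMeasurable.prodMk hq)

theorem aestronglyMeasurable_unstableOp [CompleteSpace X] (hL : IsLinearEvolutionProcess L)
    (hs : HasExponentialSplitting L Q M γ ρ) {μ : Measure ℝ} {q : ℝ → X}
    (hq : AEStronglyMeasurable q μ) (t : ℝ) :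
    AEStronglyMeasurable (fun s => unstableOp L Q t (max t s) (q s)) μ :=
  (hs.continuous_unstableOp_right hL t).comp_aestronglyMeasurable
    (continuous_id.aestronglyMeasurable.prodMk hq)

theorem aestronglyMeasurable_greenOp [CompleteSpace X] (hL : IsLinearEvolutionProcess L)
    (hs : HasExponentialSplitting L Q M γ ρ) {μ : Measure ℝ} {q : ℝ → X}
    (hq : AEStronglyMeasurable q μ) (t : ℝ) :
    AEStronglyMeasurable (fun s => greenOp L Q t s (q s)) μ := by
  have h := AEStronglyMeasurable.piecewise (s := Iic t) measurableSet_Iic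
    (hs.aestronglyMeasurable_stableOp hL hq t).restrict
    (hs.aestronglyMeasurable_unstableOp hL hq t).neg.restrict
  refine h.congr (Eventually.of_forall fun s => ?_)
  by_cases hst : s ≤ t
  · simp [greenOp, hst]
  · simp [greenOp, hst, max_eq_right (not_le.1 hst).le]

theorem integrableOn_greenOp [CompleteSpace X] (hL : IsLinearEvolutionProcess L)
    (hs : HasExponentialSplitting L Q M γ ρ) (hρσ : ρ ≤ σ) (hσγ : σ ≤ γ) {q : ℝ → X}
    (hq : WeightedIntegrable σ τ q) (t : ℝ) :
    IntegrableOn (fun s => greenOp L Q t s (q s)) (Iic τ) :=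
  (hq.int.const_mul (M * Real.exp (-(σ * (t - τ))))).mono'
    (hs.aestronglyMeasurable_greenOp hL hq.aesm t)
    (Eventually.of_forall fun s => hs.norm_greenOp_apply_le hρσ hσγ t s τ (q s))

theorem integrableOn_stableOp [CompleteSpace X] (hL : IsLinearEvolutionProcess L)
    (hs : HasExponentialSplitting L Q M γ ρ) (hρσ : ρ ≤ σ) (hσγ : σ ≤ γ) {q : ℝ → X}
    (hq : WeightedIntegrable σ τ q) {t : ℝ} (ht : t ≤ τ) :
    IntegrableOn (fun s => stableOp L Q t s (q s)) (Iic t) :=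
  ((hs.integrableOn_greenOp hL hρσ hσγ hq t).mono_set (Iic_subset_Iic.2 ht)).congr_fun
    (fun s hst => by simp only [greenOp, if_pos (mem_Iic.1 hst)]) measurableSet_Iic

theorem integrableOn_unstableOp [CompleteSpace X] (hL : IsLinearEvolutionProcess L)
    (hs : HasExponentialSplitting L Q M γ ρ) (hρσ : ρ ≤ σ) (hσγ : σ ≤ γ) {q : ℝ → X}
    (hq : WeightedIntegrable σ τ q) (t : ℝ) :
    IntegrableOn (fun s => unstableOp L Q t s (q s)) (Ioc t τ) := by
  have := ((hs.integrableOn_greenOp hL hρσ hσγ hq t).mono_set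
    (Ioc_subset_Iic_self (a := t))).neg
  refine this.congr_fun (fun s hst => ?_) measurableSet_Ioc
  simp only [greenOp, if_neg (not_le.2 hst.1), Pi.neg_apply, neg_apply, neg_neg]

theorem greenIntegral_eq [CompleteSpace X] (hL : IsLinearEvolutionProcess L)
    (hs : HasExponentialSplitting L Q M γ ρ) (hρσ : ρ ≤ σ) (hσγ : σ ≤ γ) {q : ℝ → X}
    (hq : WeightedIntegrable σ τ q) {t : ℝ} (ht : t ≤ τ) :
    greenIntegral L Q τ q t = -(∫ s in Ioc t τ, unstableOp L Q t s (q s)) +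
      ∫ s in Iic t, stableOp L Q t s (q s) := by
  have hi := hs.integrableOn_greenOp hL hρσ hσγ hq t
  unfold greenIntegral
  rw [← Iic_union_Ioc_eq_Iic ht, setIntegral_union (Iic_disjoint_Ioc le_rfl) measurableSet_Ioc
    (hi.mono_set (Iic_subset_Iic.2 ht)) (hi.mono_set Ioc_subset_Iic_self), add_comm]
  congr 1
  · rw [← integral_neg]
    refine setIntegral_congr_fun measurableSet_Ioc fun s hst => ?_
    simp only [greenOp, if_neg (not_le.2 hst.1), neg_apply]
  · exact setIntegral_congr_fun measurableSet_Iic fun s hst => by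
      simp only [greenOp, if_pos (mem_Iic.1 hst)]

theorem greenIntegral_add [CompleteSpace X] (hL : IsLinearEvolutionProcess L)
    (hs : HasExponentialSplitting L Q M γ ρ) (hρσ : ρ ≤ σ) (hσγ : σ ≤ γ) {q p : ℝ → X}
    (hq : WeightedIntegrable σ τ q) (hp : WeightedIntegrable σ τ p) (t : ℝ) :
    greenIntegral L Q τ (fun s => q s + p s) t =
      greenIntegral L Q τ q t + greenIntegral L Q τ p t := by
  unfold greenIntegral
  rw [← integral_add (hs.integrableOn_greenOp hL hρσ hσγ hq t)
    (hs.integrableOn_greenOp hL hρσ hσγ hp t)]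
  simp only [map_add]

theorem greenIntegral_smul (τ : ℝ) (q : ℝ → X) (c : 𝕜) (t : ℝ) :
    greenIntegral L Q τ (fun s => c • q s) t = c • greenIntegral L Q τ q t := by
  unfold greenIntegral
  simp only [map_smul]
  exact integral_smul c _

theorem greenIntegral_sub [CompleteSpace X] (hL : IsLinearEvolutionProcess L)
    (hs : HasExponentialSplitting L Q M γ ρ) (hρσ : ρ ≤ σ) (hσγ : σ ≤ γ) {q p : ℝ → X}
    (hq : WeightedIntegrable σ τ q) (hp : WeightedIntegrable σ τ p) (t : ℝ) :
    greenIntegral L Q τ (fun s => q s - p s) t =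
      greenIntegral L Q τ q t - greenIntegral L Q τ p t := by
  unfold greenIntegral
  rw [← integral_sub (hs.integrableOn_greenOp hL hρσ hσγ hq t)
    (hs.integrableOn_greenOp hL hρσ hσγ hp t)]
  simp only [map_sub]

theorem norm_greenIntegral_le (hs : HasExponentialSplitting L Q M γ ρ) (hρσ : ρ ≤ σ)
    (hσγ : σ ≤ γ) {q : ℝ → X} (hq : WeightedIntegrable σ τ q) (t : ℝ) :
    ‖greenIntegral L Q τ q t‖ ≤ M * (∫ s in Iic τ, Real.exp (σ * (s - τ)) * ‖q s‖) *
      Real.exp (-(σ * (t - τ))) := by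
  refine (norm_integral_le_of_norm_le (hq.int.const_mul (M * Real.exp (-(σ * (t - τ)))))
    (Eventually.of_forall fun s => hs.norm_greenOp_apply_le hρσ hσγ t s τ (q s))).trans ?_
  rw [integral_const_mul]
  exact le_of_eq (by ring)

/-- Dominated convergence applies because, for fixed `s`, the kernel is discontinuous in `t` at most
at `t = s`, and a single `s` is a null set. -/
theorem continuous_greenIntegral [CompleteSpace X] (hL : IsLinearEvolutionProcess L)
    (hs : HasExponentialSplitting L Q M γ ρ) (hρσ : ρ ≤ σ) (hσγ : σ ≤ γ) {q : ℝ → X}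
    (hq : WeightedIntegrable σ τ q) : Continuous (greenIntegral L Q τ q) := by
  have hM := hs.M_pos
  rw [continuous_iff_continuousAt]
  intro t₀
  refine continuousAt_of_dominated
    (bound := fun s => M * (Real.exp (-(σ * (t₀ - τ))) + 1) * (Real.exp (σ * (s - τ)) * ‖q s‖))
    (Eventually.of_forall fun t => hs.aestronglyMeasurable_greenOp hL hq.aesm t) ?_
    (hq.int.const_mul _) ?_
  · have : ∀ᶠ t in 𝓝 t₀, Real.exp (-(σ * (t - τ))) < Real.exp (-(σ * (t₀ - τ))) + 1 :=
      (show Continuous fun t => Real.exp (-(σ * (t - τ))) by fun_prop).continuousAt.eventually_lt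
        continuousAt_const (by linarith)
    filter_upwards [this] with t ht
    refine Eventually.of_forall fun s => (hs.norm_greenOp_apply_le hρσ hσγ t s τ (q s)).trans ?_
    gcongr
  · have hne : ∀ᵐ s : ℝ ∂volume.restrict (Iic τ), s ≠ t₀ :=
      ae_restrict_of_ae (Measure.ae_ne volume t₀)
    filter_upwards [hne] with s hst
    rcases lt_or_gt_of_ne hst with h | h
    · refine ((continuousOn_stableOp_left (Q := Q) hL s (q s)).continuousAt (Ici_mem_nhds h)).congr ?_
      filter_upwards [Ioi_mem_nhds h] with t ht
      simp only [greenOp, if_pos (mem_Ioi.1 ht).le]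
    · refine ((hs.continuousOn_unstableOp_left hL s (q s)).continuousAt
        (Iic_mem_nhds h)).neg.congr ?_
      filter_upwards [Iio_mem_nhds h] with t ht
      simp only [greenOp, if_neg (not_le.2 (mem_Iio.1 ht)), neg_apply, Pi.neg_apply]

/-- The integral over `s ≤ t` lies in the stable space and is annihilated. Only the forcing between
`t` and `τ` is left, so the unstable component vanishes at `t = τ`. -/
theorem unstableOp_greenIntegral [CompleteSpace X] (hL : IsLinearEvolutionProcess L)
    (hs : HasExponentialSplitting L Q M γ ρ) (hρσ : ρ ≤ σ) (hσγ : σ ≤ γ) {q : ℝ → X}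
    (hq : WeightedIntegrable σ τ q) {r t : ℝ} (hr : r ≤ t) (ht : t ≤ τ) :
    unstableOp L Q r t (greenIntegral L Q τ q t) =
      -∫ s in Ioc t τ, unstableOp L Q r s (q s) := by
  rw [hs.greenIntegral_eq hL hρσ hσγ hq ht, map_add, map_neg,
    ← ContinuousLinearMap.integral_comp_comm _ (hs.integrableOn_unstableOp hL hρσ hσγ hq t),
    ← ContinuousLinearMap.integral_comp_comm _ (hs.integrableOn_stableOp hL hρσ hσγ hq ht),
    setIntegral_congr_fun (g := fun _ => (0 : X)) measurableSet_Iic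
      (fun s hst => hs.unstableOp_stableOp hr (mem_Iic.1 hst) (q s)),
    setIntegral_congr_fun measurableSet_Ioc
      (fun s hst => hs.unstableOp_comp hL hr (mem_Ioc.1 hst).1.le (q s))]
  simp

theorem stableOp_greenIntegral [CompleteSpace X] (hL : IsLinearEvolutionProcess L)
    (hs : HasExponentialSplitting L Q M γ ρ) (hρσ : ρ ≤ σ) (hσγ : σ ≤ γ) {q : ℝ → X}
    (hq : WeightedIntegrable σ τ q) {r t : ℝ} (hr : t ≤ r) (ht : t ≤ τ) :
    stableOp L Q r t (greenIntegral L Q τ q t) =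
      ∫ s in Iic t, stableOp L Q r s (q s) := by
  rw [hs.greenIntegral_eq hL hρσ hσγ hq ht, map_add, map_neg,
    ← ContinuousLinearMap.integral_comp_comm _ (hs.integrableOn_unstableOp hL hρσ hσγ hq t),
    ← ContinuousLinearMap.integral_comp_comm _ (hs.integrableOn_stableOp hL hρσ hσγ hq ht),
    setIntegral_congr_fun (g := fun _ => (0 : X)) measurableSet_Ioc
      (fun s hst => hs.stableOp_unstableOp (mem_Ioc.1 hst).1.le r (q s)),
    setIntegral_congr_fun measurableSet_Iic
      (fun s hst => hs.stableOp_comp hL (mem_Iic.1 hst) hr (q s))]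
  simp

/-- The variation of constants formula for the Green integral. -/
theorem greenIntegral_eq_forward [CompleteSpace X] (hL : IsLinearEvolutionProcess L)
    (hs : HasExponentialSplitting L Q M γ ρ) (hρσ : ρ ≤ σ) (hσγ : σ ≤ γ) {q : ℝ → X}
    (hq : WeightedIntegrable σ τ q) {r t : ℝ} (hr : r ≤ t) (ht : t ≤ τ) :
    greenIntegral L Q τ q t =
      L t r (greenIntegral L Q τ q r) + ∫ s in r..t, L t s (q s) := by
  have hi := hs.integrableOn_greenOp hL hρσ hσγ hq
  rw [← sub_eq_iff_eq_add', intervalIntegral.integral_of_le hr]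
  unfold greenIntegral
  rw [← ContinuousLinearMap.integral_comp_comm _ (hi r),
    ← integral_sub (hi t) ((L t r).integrable_comp (hi r)),
    ← inter_eq_self_of_subset_right (show Ioc r t ⊆ Iic τ from fun s hst => hst.2.trans ht),
    ← setIntegral_indicator measurableSet_Ioc]
  refine setIntegral_congr_fun measurableSet_Iic fun s _ => ?_
  simp only [greenOp, indicator_apply, mem_Ioc]
  -- Outside `(r, t]` the kernel is carried exactly by `L t r`. Inside, the branches at `t` and `r`
  -- differ, and their jump `L(t,s)(I - Q(s)) + L(t,s)Q(s)` is `L(t,s)`.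
  by_cases h1 : s ≤ r
  · rw [if_pos h1, if_pos (h1.trans hr), if_neg (fun h => not_le.2 h.1 h1),
      forward_stableOp hL h1 hr, sub_self]
  · have h1' := (not_le.1 h1)
    by_cases h2 : s ≤ t
    · rw [if_neg h1, if_pos h2, if_pos ⟨h1', h2⟩, neg_apply, map_neg,
        ← hL.comp_apply h1'.le h2, hs.forward_unstableOp h1'.le, stableOp_apply, map_sub]
      abel
    · rw [if_neg h1, if_neg h2, if_neg (fun h => h2 h.2), neg_apply,
        neg_apply, map_neg,
        hs.forward_unstableOp_of_le hL hr (not_le.1 h2).le, sub_self]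

/-- The contraction estimate for the Green integral in the moving norms. -/
theorem movingNorm_greenIntegral_le [CompleteSpace X] (hL : IsLinearEvolutionProcess L)
    (hs : HasExponentialSplitting L Q M γ ρ) (hΓ : IsAdmissibleNorm Γ) {σ' : ℝ} (hρσ' : ρ ≤ σ')
    (hσγ' : σ' ≤ γ) (hρσ : ρ < σ) (hσγ : σ < γ) {q : ℝ → X} (hq : WeightedIntegrable σ' τ q)
    {a b : ℝ} (ha : 0 ≤ a)
    (hN : ∀ s ≤ τ, unstableNorm L Q ρ s (q s) ≤ a * Real.exp (-(σ * (s - τ))))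
    (hS : ∀ s ≤ τ, stableNorm L Q γ s (q s) ≤ b * Real.exp (-(σ * (s - τ))))
    {t : ℝ} (ht : t ≤ τ) :
    movingNorm L Q γ ρ Γ t (greenIntegral L Q τ q t) ≤
      Γ (a / (σ - ρ), b / (γ - σ)) * Real.exp (-(σ * (t - τ))) := by
  have h1 : unstableNorm L Q ρ t (greenIntegral L Q τ q t) ≤
      Real.exp (-(σ * (t - τ))) * (a / (σ - ρ)) := by
    -- Testing at each `r` puts `L(r,s)Q(s)` directly on the forcing, where its seminorm at time `s`
    -- controls it. This is why `M` does not appear in the constant.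
    refine hs.unstableNorm_le_iff.2 fun r hr => ?_
    rw [hs.unstableOp_greenIntegral hL hρσ' hσγ' hq hr ht, norm_neg]
    have hint := (integrableOn_exp_mul_Ioi (show ρ - σ < 0 by linarith) t).const_mul
      (a * Real.exp (σ * τ - ρ * r))
    have hle : ‖∫ s in Ioc t τ, unstableOp L Q r s (q s)‖ ≤
        ∫ s in Ioc t τ, a * Real.exp (σ * τ - ρ * r) * Real.exp ((ρ - σ) * s) := by
      refine norm_integral_le_of_norm_le
        (IntegrableOn.mono_set (μ := volume) hint Ioc_subset_Ioi_self)
        ((ae_restrict_iff' measurableSet_Ioc).2 (Eventually.of_forall fun s hst => ?_))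
      calc ‖unstableOp L Q r s (q s)‖
          ≤ Real.exp (-(ρ * (r - s))) * (a * Real.exp (-(σ * (s - τ)))) :=
            (hs.norm_unstableOp_le_unstableNorm (hr.trans hst.1.le) _).trans
              (mul_le_mul_of_nonneg_left (hN s hst.2) (Real.exp_pos _).le)
        _ = a * Real.exp (-(ρ * (r - s)) + -(σ * (s - τ))) := by rw [Real.exp_add]; ring
        _ = a * Real.exp ((σ * τ - ρ * r) + (ρ - σ) * s) := by congr 2; ring
        _ = _ := by rw [Real.exp_add]; ring
    -- Enlarging the domain to `(t, ∞)` uses `0 ≤ a` and gives an explicit integral independent of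
    -- `τ - t`.
    have hle' := hle.trans (setIntegral_mono_set (s := Ioc t τ) (t := Ioi t) hint
      (Eventually.of_forall fun s => by positivity) Ioc_subset_Ioi_self.eventuallyLE)
    rw [integral_const_mul, integral_exp_mul_Ioi (by linarith)] at hle'
    refine (mul_le_mul_of_nonneg_left hle' (Real.exp_pos _).le).trans (le_of_eq ?_)
    have hne : σ - ρ ≠ 0 := by linarith
    have hne' : ρ - σ ≠ 0 := by linarith
    have : Real.exp (-(σ * (t - τ))) = Real.exp (ρ * (r - t)) *
        (Real.exp (σ * τ - ρ * r) * Real.exp ((ρ - σ) * t)) := by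
      rw [← Real.exp_add, ← Real.exp_add]; congr 1; ring
    rw [this]
    field_simp
    ring
  have h2 : stableNorm L Q γ t (greenIntegral L Q τ q t) ≤
      Real.exp (-(σ * (t - τ))) * (b / (γ - σ)) := by
    refine hs.stableNorm_le_iff.2 fun r hr => ?_
    rw [hs.stableOp_greenIntegral hL hρσ' hσγ' hq hr ht]
    have hint := (integrableOn_exp_mul_Iic (show 0 < γ - σ by linarith) t).const_mul
      (b * Real.exp (σ * τ - γ * r))
    have hle : ‖∫ s in Iic t, stableOp L Q r s (q s)‖ ≤
        ∫ s in Iic t, b * Real.exp (σ * τ - γ * r) * Real.exp ((γ - σ) * s) := by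
      refine norm_integral_le_of_norm_le hint
        ((ae_restrict_iff' measurableSet_Iic).2 (Eventually.of_forall fun s hst => ?_))
      calc ‖stableOp L Q r s (q s)‖
          ≤ Real.exp (-(γ * (r - s))) * (b * Real.exp (-(σ * (s - τ)))) :=
            (hs.norm_stableOp_le_stableNorm ((mem_Iic.1 hst).trans hr) _).trans
              (mul_le_mul_of_nonneg_left (hS s ((mem_Iic.1 hst).trans ht)) (Real.exp_pos _).le)
        _ = b * Real.exp (-(γ * (r - s)) + -(σ * (s - τ))) := by rw [Real.exp_add]; ring
        _ = b * Real.exp ((σ * τ - γ * r) + (γ - σ) * s) := by congr 2; ring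
        _ = _ := by rw [Real.exp_add]; ring
    rw [integral_const_mul, integral_exp_mul_Iic (by linarith)] at hle
    refine (mul_le_mul_of_nonneg_left hle (Real.exp_pos _).le).trans (le_of_eq ?_)
    have : Real.exp (-(σ * (t - τ))) = Real.exp (γ * (r - t)) *
        (Real.exp (σ * τ - γ * r) * Real.exp ((γ - σ) * t)) := by
      rw [← Real.exp_add, ← Real.exp_add]; congr 1; ring
    rw [this]
    ring
  refine (hs.movingNorm_le hΓ h1 h2).trans (le_of_eq ?_)
  rw [hΓ.scale (Real.exp_pos _).le, mul_comm]

end HasExponentialSplitting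

end

section

variable {𝕜 : Type*} [RCLike 𝕜]
variable {X : Type*} [NormedAddCommGroup X] [NormedSpace ℝ X] [NormedSpace 𝕜 X]
variable {L : ℝ → ℝ → X →L[𝕜] X} {Q : ℝ → X →L[𝕜] X} {M γ ρ : ℝ} {Γ : ℝ × ℝ → ℝ}
variable {σ τ L₁ L₂ : ℝ} {g : ℝ → X → X}

/-! ### Fixed points in the weighted space -/

/-- The bound `‖z(t)‖_t ≤ B e^{-σ(t - τ)}` for `t ≤ τ`. -/
def ExpBounded (L : ℝ → ℝ → X →L[𝕜] X) (Q : ℝ → X →L[𝕜] X) (γ ρ : ℝ) (Γ : ℝ × ℝ → ℝ)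
    (σ τ B : ℝ) (z : ℝ → X) : Prop :=
  ∀ t ≤ τ, movingNorm L Q γ ρ Γ t (z t) ≤ B * Real.exp (-(σ * (t - τ)))

/-- Split Lipschitz nonlinearities whose superposition operator maps continuous functions to
measurable functions. -/
structure IsSplitNonlinearity (L : ℝ → ℝ → X →L[𝕜] X) (Q : ℝ → X →L[𝕜] X) (γ ρ : ℝ)
    (Γ : ℝ × ℝ → ℝ) (L₁ L₂ : ℝ) (g : ℝ → X → X) : Prop where
  lip : IsSplitLipschitz L Q γ ρ Γ g L₁ L₂
  zero : ∀ t, g t 0 = 0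
  meas : ∀ z : ℝ → X, Continuous z → AEStronglyMeasurable (fun s => g s (z s)) volume

theorem ExpBounded.sub {B C : ℝ} {z w : ℝ → X} (hs : HasExponentialSplitting L Q M γ ρ)
    (hΓ : IsAdmissibleNorm Γ) (hz : ExpBounded L Q γ ρ Γ σ τ B z)
    (hw : ExpBounded L Q γ ρ Γ σ τ C w) :
    ExpBounded L Q γ ρ Γ σ τ (B + C) fun t => z t - w t := fun t ht => by
  rw [add_mul]
  exact (hs.movingNorm_sub_le hΓ t _ _).trans (add_le_add (hz t ht) (hw t ht))

theorem ExpBounded.add {B C : ℝ} {z w : ℝ → X} (hs : HasExponentialSplitting L Q M γ ρ)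
    (hΓ : IsAdmissibleNorm Γ) (hz : ExpBounded L Q γ ρ Γ σ τ B z)
    (hw : ExpBounded L Q γ ρ Γ σ τ C w) :
    ExpBounded L Q γ ρ Γ σ τ (B + C) fun t => z t + w t := fun t ht => by
  rw [add_mul]
  exact (hs.movingNorm_add_le hΓ t _ _).trans (add_le_add (hz t ht) (hw t ht))

theorem ExpBounded.smul {B : ℝ} {z : ℝ → X} (hs : HasExponentialSplitting L Q M γ ρ)
    (hΓ : IsAdmissibleNorm Γ) (hz : ExpBounded L Q γ ρ Γ σ τ B z) (c : 𝕜) :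
    ExpBounded L Q γ ρ Γ σ τ (‖c‖ * B) fun t => c • z t := fun t ht => by
  rw [mul_assoc]
  exact (hs.movingNorm_smul_le hΓ t _ _).trans
    (mul_le_mul_of_nonneg_left (hz t ht) (norm_nonneg _))

theorem ExpBounded.nonneg {B : ℝ} {z : ℝ → X} (hΓ : IsAdmissibleNorm Γ)
    (hz : ExpBounded L Q γ ρ Γ σ τ B z) : 0 ≤ B := by
  have h := (hΓ.nonneg _).trans (hz τ le_rfl)
  simpa using h

theorem ExpBounded.mono_exponent {B σ' : ℝ} {z : ℝ → X} (hΓ : IsAdmissibleNorm Γ)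
    (hz : ExpBounded L Q γ ρ Γ σ τ B z) (hσ : σ ≤ σ') : ExpBounded L Q γ ρ Γ σ' τ B z :=
  fun t ht => (hz t ht).trans <| by
    have := hz.nonneg hΓ
    gcongr B * Real.exp ?_
    nlinarith

namespace HasExponentialSplitting

/-- A priori estimate for `w = (forcing) + greenIntegral q` with `q` dominated by `w`. -/
theorem expBounded_of_forced [CompleteSpace X] (hL : IsLinearEvolutionProcess L)
    (hs : HasExponentialSplitting L Q M γ ρ) (hΓ : IsAdmissibleNorm Γ) (hρσ : ρ < σ)
    (hσγ : σ < γ) (hL₁ : 0 ≤ L₁) (hgap : Γ (L₁ / (σ - ρ), L₂ / (γ - σ)) < 1)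
    {σ' : ℝ} (hρσ' : ρ ≤ σ') (hσγ' : σ' ≤ γ) {q w : ℝ → X} (hq : WeightedIntegrable σ' τ q)
    {B D : ℝ} (hw : ExpBounded L Q γ ρ Γ σ τ B w)
    (hN : ∀ s ≤ τ, unstableNorm L Q ρ s (q s) ≤ L₁ * movingNorm L Q γ ρ Γ s (w s))
    (hS : ∀ s ≤ τ, stableNorm L Q γ s (q s) ≤ L₂ * movingNorm L Q γ ρ Γ s (w s))
    (hL₂ : 0 ≤ L₂)
    (hD : ExpBounded L Q γ ρ Γ σ τ D fun t => w t - greenIntegral L Q τ q t) :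
    ExpBounded L Q γ ρ Γ σ τ (D / (1 - Γ (L₁ / (σ - ρ), L₂ / (γ - σ)))) w := by
  set κ := Γ (L₁ / (σ - ρ), L₂ / (γ - σ)) with hκ
  -- The bound `B` serves only to make this supremum `K` finite. The contraction estimate then gives
  -- `K ≤ D + κK`, which is absorbed because `κ < 1`, and `B` disappears.
  set S : Set ℝ := (fun t => movingNorm L Q γ ρ Γ t (w t) * Real.exp (σ * (t - τ))) '' Iic τ
  have hexp : ∀ t, Real.exp (-(σ * (t - τ))) = (Real.exp (σ * (t - τ)))⁻¹ :=
    fun t => Real.exp_neg _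
  have hSb : BddAbove S := by
    refine ⟨B, ?_⟩
    rintro _ ⟨t, ht, rfl⟩
    have := hw t ht
    rwa [hexp, ← div_eq_mul_inv, le_div_iff₀ (Real.exp_pos _)] at this
  have hSn : S.Nonempty := ⟨_, τ, self_mem_Iic, rfl⟩
  have hK : ExpBounded L Q γ ρ Γ σ τ (sSup S) w := fun t ht => by
    rw [hexp, ← div_eq_mul_inv, le_div_iff₀ (Real.exp_pos _)]
    exact le_csSup hSb ⟨t, ht, rfl⟩
  have hK0 : 0 ≤ sSup S := hK.nonneg hΓ
  have hJ : ExpBounded L Q γ ρ Γ σ τ (sSup S * κ) (greenIntegral L Q τ q) := fun t ht => by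
    refine (hs.movingNorm_greenIntegral_le (a := sSup S * L₁) (b := sSup S * L₂) hL hΓ hρσ' hσγ'
      hρσ hσγ hq (by positivity) (fun s hst => (hN s hst).trans ?_)
      (fun s hst => (hS s hst).trans ?_) ht).trans (le_of_eq ?_)
    · rw [mul_comm _ L₁, mul_assoc]
      exact mul_le_mul_of_nonneg_left (hK s hst) hL₁
    · rw [mul_comm _ L₂, mul_assoc]
      exact mul_le_mul_of_nonneg_left (hK s hst) hL₂
    · rw [mul_div_assoc, mul_div_assoc, hΓ.scale hK0]
  have hle : sSup S ≤ D + sSup S * κ := by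
    refine csSup_le hSn ?_
    rintro _ ⟨t, ht, rfl⟩
    have := (hD.add hs hΓ hJ) t ht
    simp only [sub_add_cancel] at this
    rwa [hexp, ← div_eq_mul_inv, le_div_iff₀ (Real.exp_pos _)] at this
  have hle' : sSup S ≤ D / (1 - κ) := by
    rw [le_div_iff₀ (by linarith)]
    linarith
  exact fun t ht => (hK t ht).trans (mul_le_mul_of_nonneg_right hle' (Real.exp_pos _).le)

theorem norm_sub_le_of_lip (hL : IsLinearEvolutionProcess L)
    (hs : HasExponentialSplitting L Q M γ ρ) (hg : IsSplitLipschitz L Q γ ρ Γ g L₁ L₂)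
    (t : ℝ) (u v : X) : ‖g t u - g t v‖ ≤ (L₁ + L₂) * movingNorm L Q γ ρ Γ t (u - v) := by
  rw [add_mul]
  exact (hs.norm_le_unstableNorm_add hL t _).trans (add_le_add (hg t u v).1 (hg t u v).2)

theorem expBounded_of_norm {c B : ℝ} (hc : 0 < c)
    (h : ∀ τ x, movingNorm L Q γ ρ Γ τ x ≤ c * ‖x‖) {z : ℝ → X}
    (hz : ∀ t ≤ τ, ‖z t‖ ≤ B * Real.exp (-(σ * (t - τ)))) :
    ExpBounded L Q γ ρ Γ σ τ (c * B) z := fun t ht => by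
  rw [mul_assoc]
  exact (h t _).trans (mul_le_mul_of_nonneg_left (hz t ht) hc.le)

theorem aesm_superposition (hg : IsSplitNonlinearity L Q γ ρ Γ L₁ L₂ g) {z : ℝ → X}
    (hz : ContinuousOn z (Iic τ)) :
    AEStronglyMeasurable (fun s => g s (z s)) (volume.restrict (Iic τ)) := by
  have hc : Continuous fun s => z (min s τ) :=
    hz.comp_continuous (by fun_prop) fun s => min_le_right s τ
  refine (hg.meas _ hc).restrict.congr ?_
  refine (ae_restrict_iff' measurableSet_Iic).2 (Eventually.of_forall fun s hst => ?_)
  simp only [min_eq_left (mem_Iic.1 hst)]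

theorem weightedIntegrable_superposition (hL : IsLinearEvolutionProcess L)
    (hs : HasExponentialSplitting L Q M γ ρ) (hL₁ : 0 ≤ L₁) (hL₂ : 0 ≤ L₂)
    (hg : IsSplitNonlinearity L Q γ ρ Γ L₁ L₂ g) {σ' B : ℝ} (hσ : σ < σ') {z : ℝ → X}
    (hz : ContinuousOn z (Iic τ)) (hzB : ExpBounded L Q γ ρ Γ σ τ B z) :
    WeightedIntegrable σ' τ fun s => g s (z s) := by
  refine weightedIntegrable_of_norm_le (C := (L₁ + L₂) * B) hσ (aesm_superposition hg hz)
    fun s hst => ?_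
  have := hs.norm_sub_le_of_lip hL hg.lip s (z s) 0
  rw [hg.zero, sub_zero, sub_zero] at this
  rw [mul_assoc]
  exact this.trans (mul_le_mul_of_nonneg_left (hzB s hst) (by positivity))

/-- Two solutions of the fixed point equation with different forcing. -/
theorem expBounded_sub_of_fixedPoint [CompleteSpace X] (hL : IsLinearEvolutionProcess L)
    (hs : HasExponentialSplitting L Q M γ ρ) (hΓ : IsAdmissibleNorm Γ) (hρσ : ρ < σ)
    (hσγ : σ < γ) (hL₁ : 0 ≤ L₁) (hL₂ : 0 ≤ L₂)
    (hgap : Γ (L₁ / (σ - ρ), L₂ / (γ - σ)) < 1)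
    (hg : IsSplitNonlinearity L Q γ ρ Γ L₁ L₂ g) {z w ζ ξ : ℝ → X} {B C D : ℝ}
    (hz : ContinuousOn z (Iic τ)) (hzB : ExpBounded L Q γ ρ Γ σ τ B z)
    (hw : ContinuousOn w (Iic τ)) (hwB : ExpBounded L Q γ ρ Γ σ τ C w)
    (hze : ∀ t ≤ τ, z t = ζ t + greenIntegral L Q τ (fun s => g s (z s)) t)
    (hwe : ∀ t ≤ τ, w t = ξ t + greenIntegral L Q τ (fun s => g s (w s)) t)
    (hD : ExpBounded L Q γ ρ Γ σ τ D fun t => ζ t - ξ t) :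
    ExpBounded L Q γ ρ Γ σ τ (D / (1 - Γ (L₁ / (σ - ρ), L₂ / (γ - σ)))) fun t => z t - w t := by
  have hz' := hs.weightedIntegrable_superposition hL hL₁ hL₂ hg hσγ hz hzB
  have hw' := hs.weightedIntegrable_superposition hL hL₁ hL₂ hg hσγ hw hwB
  have hργ : ρ ≤ γ := hs.lt.le
  refine hs.expBounded_of_forced hL hΓ hρσ hσγ hL₁ hgap (σ' := γ) hργ le_rfl
    (q := fun s => g s (z s) - g s (w s)) ?_ (hzB.sub hs hΓ hwB)
    (fun s _ => (hg.lip s _ _).1) (fun s _ => (hg.lip s _ _).2) hL₂ fun t ht => ?_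
  · simpa [sub_eq_add_neg] using hz'.add (hw'.smul (-1 : 𝕜))
  · beta_reduce
    rw [hs.greenIntegral_sub hL hργ le_rfl hz' hw', hze t ht, hwe t ht]
    rw [add_sub_add_comm, add_sub_cancel_right]
    exact hD t ht

theorem eqOn_of_fixedPoint [CompleteSpace X] (hL : IsLinearEvolutionProcess L)
    (hs : HasExponentialSplitting L Q M γ ρ) (hΓ : IsAdmissibleNorm Γ) (hρσ : ρ < σ)
    (hσγ : σ < γ) (hL₁ : 0 ≤ L₁) (hL₂ : 0 ≤ L₂)
    (hgap : Γ (L₁ / (σ - ρ), L₂ / (γ - σ)) < 1)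
    (hg : IsSplitNonlinearity L Q γ ρ Γ L₁ L₂ g) {z w ζ : ℝ → X} {B C : ℝ}
    (hz : ContinuousOn z (Iic τ)) (hzB : ExpBounded L Q γ ρ Γ σ τ B z)
    (hw : ContinuousOn w (Iic τ)) (hwB : ExpBounded L Q γ ρ Γ σ τ C w)
    (hze : ∀ t ≤ τ, z t = ζ t + greenIntegral L Q τ (fun s => g s (z s)) t)
    (hwe : ∀ t ≤ τ, w t = ζ t + greenIntegral L Q τ (fun s => g s (w s)) t) :
    EqOn z w (Iic τ) := fun t ht => by
  obtain ⟨c, hc, hc1, -⟩ := hs.exists_movingNorm_equiv hL hΓ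
  have h := hs.expBounded_sub_of_fixedPoint hL hΓ hρσ hσγ hL₁ hL₂ hgap hg hz hzB hw hwB hze hwe
    (D := 0) (fun t _ => by simp [movingNorm_zero hΓ hs]) t ht
  rw [zero_div, zero_mul] at h
  have h' := (hc1 t (z t - w t)).trans (mul_le_mul_of_nonneg_left h hc.le)
  rw [mul_zero, norm_le_zero_iff] at h'
  exact sub_eq_zero.1 h'

/-- Existence of a fixed point in the weighted space. -/
theorem exists_fixedPoint [CompleteSpace X] (hL : IsLinearEvolutionProcess L)
    (hs : HasExponentialSplitting L Q M γ ρ) (hΓ : IsAdmissibleNorm Γ) (hρσ : ρ < σ)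
    (hσγ : σ < γ) (hL₁ : 0 ≤ L₁) (hL₂ : 0 ≤ L₂)
    (hgap : Γ (L₁ / (σ - ρ), L₂ / (γ - σ)) < 1)
    (hg : IsSplitNonlinearity L Q γ ρ Γ L₁ L₂ g) {ζ : ℝ → X} {A : ℝ}
    (hζ : ContinuousOn ζ (Iic τ)) (hζA : ∀ t ≤ τ, ‖ζ t‖ ≤ A * Real.exp (-(σ * (t - τ)))) :
    ∃ z : ℝ → X, Continuous z ∧ (∃ B, ExpBounded L Q γ ρ Γ σ τ B z) ∧
      ∀ t ≤ τ, z t = ζ t + greenIntegral L Q τ (fun s => g s (z s)) t := by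
  obtain ⟨c, hc, hc1, hc2⟩ := hs.exists_movingNorm_equiv hL hΓ
  set κ := Γ (L₁ / (σ - ρ), L₂ / (γ - σ)) with hκ
  have hκ0 : 0 ≤ κ := hΓ.nonneg _
  have hργ : ρ ≤ γ := hs.lt.le
  -- Bounded continuous functions on the whole line, with the original norm, provide a complete
  -- space. The weight `e` turns them into curves with the required growth, and the clamp `m`
  -- ignores times beyond `τ`.
  let Y := BoundedContinuousFunction ℝ X
  let m : ℝ → ℝ := fun t => min t τ
  have hmc : Continuous m := by fun_prop
  have hm : ∀ t, m t ≤ τ := fun t => min_le_right t τ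
  have hm' : ∀ t ≤ τ, m t = t := fun t ht => min_eq_left ht
  let e : ℝ → ℝ := fun t => Real.exp (σ * (m t - τ))
  have he0 : ∀ t, 0 < e t := fun t => Real.exp_pos _
  have hec : Continuous e := by fun_prop
  have he' : ∀ t ≤ τ, (e t)⁻¹ = Real.exp (-(σ * (t - τ))) := fun t ht => by
    simp only [e, hm' t ht, Real.exp_neg]
  let uw : Y → ℝ → X := fun y t => (e t)⁻¹ • y t
  have huwc : ∀ y, Continuous (uw y) := fun y =>
    (hec.inv₀ fun t => (he0 t).ne').smul y.continuous
  have huwB : ∀ y y' : Y, ExpBounded L Q γ ρ Γ σ τ (c * dist y y') fun t => uw y t - uw y' t :=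
    fun y y' => expBounded_of_norm hc hc2 fun t ht => by
      simp only [uw]
      rw [← smul_sub, norm_smul, Real.norm_of_nonneg (inv_nonneg.2 (he0 t).le), he' t ht, mul_comm,
        ← dist_eq_norm]
      exact mul_le_mul_of_nonneg_right (BoundedContinuousFunction.dist_coe_le_dist t)
        (Real.exp_pos _).le
  have huw0 : ∀ t, uw 0 t = 0 := fun t => smul_zero _
  have huwB0 : ∀ y : Y, ExpBounded L Q γ ρ Γ σ τ (c * dist y 0) (uw y) := fun y t ht => by
    simpa only [huw0, sub_zero] using huwB y 0 t ht
  have hgi : ∀ y : Y, WeightedIntegrable γ τ fun s => g s (uw y s) := fun y =>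
    hs.weightedIntegrable_superposition hL hL₁ hL₂ hg hσγ (huwc y).continuousOn (huwB0 y)
  let F : Y → ℝ → X := fun y t =>
    ζ (m t) + greenIntegral L Q τ (fun s => g s (uw y s)) (m t)
  have hFc : ∀ y, Continuous (F y) := fun y =>
    (hζ.comp_continuous hmc hm).add
      ((hs.continuous_greenIntegral hL hργ le_rfl (hgi y)).comp hmc)
  have hstep : ∀ (y y' : Y) (K : ℝ), 0 ≤ K →
      (ExpBounded L Q γ ρ Γ σ τ K fun t => uw y t - uw y' t) →
      ExpBounded L Q γ ρ Γ σ τ (K * κ) fun t => F y t - F y' t := fun y y' K hK0 hK t ht => by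
    have hq : WeightedIntegrable γ τ fun s => g s (uw y s) - g s (uw y' s) := by
      simpa [sub_eq_add_neg] using (hgi y).add ((hgi y').smul (-1 : 𝕜))
    simp only [F]
    rw [add_sub_add_left_eq_sub, ← hs.greenIntegral_sub hL hργ le_rfl (hgi y) (hgi y'), hm' t ht]
    refine (hs.movingNorm_greenIntegral_le (a := K * L₁) (b := K * L₂) hL hΓ hργ le_rfl
      hρσ hσγ hq (by positivity) (fun s hst => (hg.lip s _ _).1.trans ?_)
      (fun s hst => (hg.lip s _ _).2.trans ?_) ht).trans (le_of_eq ?_)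
    · rw [mul_comm _ L₁, mul_assoc]
      exact mul_le_mul_of_nonneg_left (hK s hst) hL₁
    · rw [mul_comm _ L₂, mul_assoc]
      exact mul_le_mul_of_nonneg_left (hK s hst) hL₂
    · rw [mul_div_assoc, mul_div_assoc, hΓ.scale hK0]
  have hFB : ∀ y t, ‖e t • F y t‖ ≤ A + c * (c * dist y 0 * κ) := fun y t => by
    have h1 := hζA (m t) (hm t)
    have h2 := hstep y 0 _ (by positivity) (huwB y 0) (m t) (hm t)
    have h3 : F y t = ζ (m t) + (F y (m t) - F 0 (m t)) := by
      have h0 : greenIntegral L Q τ (fun s => g s (uw 0 s)) (m t) = 0 := by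
        simp [greenIntegral, huw0, hg.zero]
      simp only [F, hm' _ (hm t), h0]
      rw [add_zero, add_sub_cancel_left]
    rw [norm_smul, Real.norm_of_nonneg (he0 t).le, mul_comm, ← le_div_iff₀ (he0 t), div_eq_mul_inv,
      add_mul, h3]
    have h4 : (e t)⁻¹ = Real.exp (-(σ * (m t - τ))) := (Real.exp_neg _).symm
    rw [h4, mul_assoc c]
    exact (norm_add_le _ _).trans (add_le_add h1
      ((hc1 (m t) _).trans (mul_le_mul_of_nonneg_left h2 hc.le)))
  let Φ : Y → Y := fun y => BoundedContinuousFunction.ofNormedAddCommGroup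
    (fun t => e t • F y t) (hec.smul (hFc y)) _ (hFB y)
  have hΦ : ∀ y t, Φ y t = e t • F y t := fun y t => rfl
  have huwΦ : ∀ y t, uw (Φ y) t = F y t := fun y t => by
    simp only [uw, hΦ]
    rw [inv_smul_smul₀ (he0 t).ne']
  -- One step contracts by `κ` in the moving norms only. In the original norm each passage between
  -- the norms costs a factor `c`, so this cost is paid once for `n` steps rather than at every
  -- step.
  have hiter : ∀ (n : ℕ) (y y' : Y), ExpBounded L Q γ ρ Γ σ τ (c * dist y y' * κ ^ n)
      fun t => uw (Φ^[n] y) t - uw (Φ^[n] y') t := fun n y y' => by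
    induction n with
    | zero => simpa using huwB y y'
    | succ n ih =>
      simp only [Function.iterate_succ_apply', huwΦ, pow_succ, ← mul_assoc]
      exact hstep _ _ _ (by positivity) ih
  -- At least one application of `Φ` is needed: its values depend on `t` only through `m t`, so
  -- estimates on `(-∞, τ]` bound the full sup norm, which fails for arbitrary elements of `Y`.
  have hlip : ∀ (n : ℕ) (y y' : Y),
      dist (Φ^[n + 1] y) (Φ^[n + 1] y') ≤ c * c * κ ^ (n + 1) * dist y y' := fun n y y' => by
    refine (BoundedContinuousFunction.dist_le (by positivity)).2 fun t => ?_
    have h := hiter (n + 1) y y' (m t) (hm t)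
    rw [← he' _ (hm t)] at h
    simp only [Function.iterate_succ_apply', huwΦ] at h
    have hmm : ∀ y : Y, Φ y t = Φ y (m t) := fun y => by
      simp only [hΦ, e, F, hm' _ (hm t)]
    simp only [Function.iterate_succ_apply']
    rw [hmm, hmm (Φ^[n] y'), dist_eq_norm, hΦ, hΦ, ← smul_sub, norm_smul,
      Real.norm_of_nonneg (he0 _).le, mul_comm, ← le_div_iff₀ (he0 _), div_eq_mul_inv]
    refine ((hc1 _ _).trans (mul_le_mul_of_nonneg_left h hc.le)).trans (le_of_eq (by ring))
  obtain ⟨n, hn⟩ : ∃ n : ℕ, c * c * κ ^ (n + 1) < 1 := by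
    have h : Tendsto (fun n : ℕ => c * c * κ ^ (n + 1)) atTop (𝓝 (c * c * 0)) :=
      ((tendsto_pow_atTop_nhds_zero_of_lt_one hκ0 hgap).comp (tendsto_add_atTop_nat 1)).const_mul _
    rw [mul_zero] at h
    exact (h.eventually (gt_mem_nhds one_pos)).exists
  have hcontr : ContractingWith ⟨c * c * κ ^ (n + 1), by positivity⟩ Φ^[n + 1] :=
    ⟨by exact_mod_cast hn, LipschitzWith.of_dist_le_mul (hlip n)⟩
  have hfix := hcontr.isFixedPt_fixedPoint_iterate
  set y := ContractingWith.fixedPoint _ hcontr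
  have hy : Φ y = y := hfix
  refine ⟨uw y, huwc y, ⟨_, huwB0 y⟩, fun t ht => ?_⟩
  conv_lhs => rw [← hy, huwΦ]
  simp only [F, hm' t ht]

end HasExponentialSplitting

end

section

variable {𝕜 : Type*} [RCLike 𝕜]
variable {X : Type*} [NormedAddCommGroup X] [NormedSpace ℝ X] [NormedSpace 𝕜 X]
variable {L : ℝ → ℝ → X →L[𝕜] X} {Q : ℝ → X →L[𝕜] X} {M γ ρ : ℝ} {Γ : ℝ × ℝ → ℝ}
variable {σ τ L₁ L₂ : ℝ} {g f : ℝ → X → X} {T : ℝ → ℝ → X → X}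

/-! ### Mild solutions on a half-line -/

/-- The linear setting together with the gap condition at the exponent `σ`. -/
structure GapCondition (L : ℝ → ℝ → X →L[𝕜] X) (Q : ℝ → X →L[𝕜] X) (M γ ρ : ℝ)
    (Γ : ℝ × ℝ → ℝ) (L₁ L₂ σ : ℝ) : Prop where
  process : IsLinearEvolutionProcess L
  split : HasExponentialSplitting L Q M γ ρ
  norm : IsAdmissibleNorm Γ
  left : ρ < σ
  right : σ < γ
  nonneg₁ : 0 ≤ L₁
  nonneg₂ : 0 ≤ L₂
  gap : Γ (L₁ / (σ - ρ), L₂ / (γ - σ)) < 1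

/-- Solutions in `E_{σ,τ}` of the fixed point equation with nonlinearity `g`. -/
structure IsMildSolution (L : ℝ → ℝ → X →L[𝕜] X) (Q : ℝ → X →L[𝕜] X) (γ ρ : ℝ) (Γ : ℝ × ℝ → ℝ)
    (g : ℝ → X → X) (σ τ : ℝ) (η : X) (z : ℝ → X) : Prop where
  cont : ContinuousOn z (Iic τ)
  bdd : ∃ B, ExpBounded L Q γ ρ Γ σ τ B z
  eq : ∀ t ≤ τ, z t = unstableOp L Q t τ η + greenIntegral L Q τ (fun s => g s (z s)) t

/-- The gap condition persists for slightly larger exponents. -/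
theorem GapCondition.exists_larger (G : GapCondition L Q M γ ρ Γ L₁ L₂ σ) :
    ∃ σ', σ < σ' ∧ GapCondition L Q M γ ρ Γ L₁ L₂ σ' := by
  obtain ⟨hL, hs, hΓ, hρσ, hσγ, h1, h2, hgap⟩ := G
  set κ := Γ (L₁ / (σ - ρ), L₂ / (γ - σ)) with hκ
  have hκ0 : 0 ≤ κ := hΓ.nonneg _
  -- The choice `γ - σ' = (γ - σ)/δ` multiplies the second argument of `Γ` by exactly `δ` and does
  -- not increase the first, so the new constant is at most `δκ`.
  obtain ⟨δ, hδ, hδκ⟩ : ∃ δ > 1, δ * κ < 1 := by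
    refine ⟨2 / (1 + κ), ?_, ?_⟩
    · rw [gt_iff_lt, lt_div_iff₀ (by linarith)]; linarith
    · rw [div_mul_eq_mul_div, div_lt_one (by linarith)]; linarith
  have hδ0 : 0 < δ := by linarith
  have hd : (γ - σ) / δ < γ - σ := div_lt_self (by linarith) hδ
  have hd0 : 0 < (γ - σ) / δ := div_pos (by linarith) hδ0
  refine ⟨γ - (γ - σ) / δ, by linarith, hL, hs, hΓ, by linarith, by linarith, h1, h2, ?_⟩
  refine lt_of_le_of_lt (hΓ.mono (c := δ * (L₁ / (σ - ρ))) (d := δ * (L₂ / (γ - σ)))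
    (div_nonneg h1 (by linarith)) (div_nonneg h2 (by linarith)) ?_ ?_) ((hΓ.scale hδ0.le _ _).trans_lt hδκ)
  · have h3 : L₁ / (γ - (γ - σ) / δ - ρ) ≤ L₁ / (σ - ρ) :=
      div_le_div_of_nonneg_left h1 (by linarith) (by linarith)
    have h4 : 0 ≤ L₁ / (σ - ρ) := div_nonneg h1 (by linarith)
    nlinarith
  · rw [sub_sub_cancel, div_div_eq_mul_div, mul_comm δ, div_mul_eq_mul_div]

namespace HasExponentialSplitting

theorem norm_unstableOp_le_exp (hs : HasExponentialSplitting L Q M γ ρ) (hρσ : ρ ≤ σ) {t : ℝ}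
    (ht : t ≤ τ) (η : X) :
    ‖unstableOp L Q t τ η‖ ≤ M * ‖η‖ * Real.exp (-(σ * (t - τ))) := by
  have hM := hs.M_pos
  refine (hs.norm_unstableOp_apply_le ht η).trans ?_
  rw [mul_right_comm]
  gcongr M * ‖η‖ * Real.exp ?_
  nlinarith

end HasExponentialSplitting

namespace GapCondition

theorem exists_mildSolution [CompleteSpace X] (G : GapCondition L Q M γ ρ Γ L₁ L₂ σ)
    (hg : IsSplitNonlinearity L Q γ ρ Γ L₁ L₂ g) (τ : ℝ) (η : X) :
    ∃ z, Continuous z ∧ IsMildSolution L Q γ ρ Γ g σ τ η z := by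
  obtain ⟨z, hz, hb, he⟩ := G.split.exists_fixedPoint G.process G.norm G.left G.right G.nonneg₁
    G.nonneg₂ G.gap hg (G.split.continuousOn_unstableOp_left G.process τ η)
    (fun t ht => G.split.norm_unstableOp_le_exp G.left.le ht η)
  exact ⟨z, hz, hz.continuousOn, hb, he⟩

theorem mildSolution_unique [CompleteSpace X] (G : GapCondition L Q M γ ρ Γ L₁ L₂ σ)
    (hg : IsSplitNonlinearity L Q γ ρ Γ L₁ L₂ g) {η : X} {z w : ℝ → X}
    (hz : IsMildSolution L Q γ ρ Γ g σ τ η z) (hw : IsMildSolution L Q γ ρ Γ g σ τ η w) :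
    EqOn z w (Iic τ) := by
  obtain ⟨B, hB⟩ := hz.bdd
  obtain ⟨C, hC⟩ := hw.bdd
  exact G.split.eqOn_of_fixedPoint G.process G.norm G.left G.right G.nonneg₁ G.nonneg₂ G.gap hg
    hz.cont hB hw.cont hC hz.eq hw.eq

/-- Mild solutions depend Lipschitz continuously on `η`, with a constant that depends only on the
linear setting and the Lipschitz constants. -/
theorem exists_lipschitz_const [CompleteSpace X] (G : GapCondition L Q M γ ρ Γ L₁ L₂ σ) :
    ∃ C, 0 ≤ C ∧ ∀ (g : ℝ → X → X), IsSplitNonlinearity L Q γ ρ Γ L₁ L₂ g →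
      ∀ (τ : ℝ) (η θ : X) (z w : ℝ → X), IsMildSolution L Q γ ρ Γ g σ τ η z →
        IsMildSolution L Q γ ρ Γ g σ τ θ w →
        ∀ t ≤ τ, ‖z t - w t‖ ≤ C * ‖η - θ‖ * Real.exp (-(σ * (t - τ))) := by
  obtain ⟨c, hc, hc1, hc2⟩ := G.split.exists_movingNorm_equiv G.process G.norm
  have hκ := G.gap
  set κ := Γ (L₁ / (σ - ρ), L₂ / (γ - σ)) with hκd
  have hM := G.split.M_pos
  refine ⟨c * (c * M / (1 - κ)), mul_nonneg hc.le (div_nonneg (by positivity) (by linarith)),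
    fun g hg τ η θ z w hz hw t ht => ?_⟩
  obtain ⟨B, hB⟩ := hz.bdd
  obtain ⟨C, hC⟩ := hw.bdd
  have h := G.split.expBounded_sub_of_fixedPoint G.process G.norm G.left G.right G.nonneg₁
    G.nonneg₂ G.gap hg hz.cont hB hw.cont hC hz.eq hw.eq (D := c * (M * ‖η - θ‖))
    (HasExponentialSplitting.expBounded_of_norm hc hc2 fun t ht => by
      rw [← map_sub]; exact G.split.norm_unstableOp_le_exp G.left.le ht (η - θ)) t ht
  refine ((hc1 t _).trans (mul_le_mul_of_nonneg_left h hc.le)).trans (le_of_eq ?_)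
  rw [← hκd]
  ring

theorem weightedIntegrable (G : GapCondition L Q M γ ρ Γ L₁ L₂ σ)
    (hg : IsSplitNonlinearity L Q γ ρ Γ L₁ L₂ g) {z : ℝ → X} {σ' : ℝ} (hσ : σ < σ')
    (hz : ContinuousOn z (Iic τ)) (hb : ∃ B, ExpBounded L Q γ ρ Γ σ τ B z) :
    WeightedIntegrable σ' τ fun s => g s (z s) :=
  G.split.weightedIntegrable_superposition G.process G.nonneg₁ G.nonneg₂ hg hσ hz hb.choose_spec

theorem le_gamma (G : GapCondition L Q M γ ρ Γ L₁ L₂ σ) : ρ ≤ γ := G.split.lt.le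

/-- The unstable component of a mild solution at the terminal time. -/
theorem proj_mildSolution [CompleteSpace X] (G : GapCondition L Q M γ ρ Γ L₁ L₂ σ)
    (hg : IsSplitNonlinearity L Q γ ρ Γ L₁ L₂ g) {η : X} {z : ℝ → X}
    (hz : IsMildSolution L Q γ ρ Γ g σ τ η z) : Q τ (z τ) = Q τ η := by
  have hw := G.weightedIntegrable hg G.right hz.cont hz.bdd
  have h := G.split.unstableOp_greenIntegral G.process G.le_gamma le_rfl hw le_rfl (le_refl τ)
  rw [G.split.unstableOp_self G.process, Ioc_self, setIntegral_empty, neg_zero] at h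
  rw [hz.eq τ le_rfl, map_add, G.split.proj_unstableOp le_rfl,
    G.split.unstableOp_self G.process, h, add_zero]

/-- The stable component of a mild solution at the terminal time. -/
theorem stable_mildSolution [CompleteSpace X] (G : GapCondition L Q M γ ρ Γ L₁ L₂ σ)
    (hg : IsSplitNonlinearity L Q γ ρ Γ L₁ L₂ g) {η : X} {z : ℝ → X}
    (hz : IsMildSolution L Q γ ρ Γ g σ τ η z) :
    z τ - Q τ (z τ) = ∫ s in Iic τ, stableIntegrand L Q g z τ s := by
  have hw := G.weightedIntegrable hg G.right hz.cont hz.bdd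
  rw [G.proj_mildSolution hg hz, hz.eq τ le_rfl, G.split.unstableOp_self G.process,
    G.split.greenIntegral_eq G.process G.le_gamma le_rfl hw le_rfl, Ioc_self, setIntegral_empty,
    neg_zero, zero_add, add_sub_cancel_left]
  simp only [stableOp_apply, stableIntegrand]

/-- The datum enters only through `L(t,τ)Q(τ)η`, so its stable part is invisible. This is why the
manifold is parametrised by the unstable space. -/
theorem mildSolution_proj_iff (G : GapCondition L Q M γ ρ Γ L₁ L₂ σ) {η : X} {z : ℝ → X} :
    IsMildSolution L Q γ ρ Γ g σ τ (Q τ η) z ↔ IsMildSolution L Q γ ρ Γ g σ τ η z := by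
  constructor <;> rintro ⟨h1, h2, h3⟩ <;> refine ⟨h1, h2, fun t ht => ?_⟩
  · rw [← G.split.unstableOp_proj ht]; exact h3 t ht
  · rw [G.split.unstableOp_proj ht]; exact h3 t ht

theorem memE_iff {z : ℝ → X} : MemE L Q γ ρ Γ σ τ z ↔
    ContinuousOn z (Iic τ) ∧ ∃ B, ExpBounded L Q γ ρ Γ σ τ B z := by
  refine and_congr Iff.rfl (exists_congr fun B => ?_)
  unfold ExpBounded
  simp only [mem_upperBounds, forall_mem_image, mem_Iic]
  refine forall₂_congr fun t _ => ?_
  rw [Real.exp_neg, ← div_eq_mul_inv, le_div_iff₀ (Real.exp_pos _), mul_comm]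

/-- Cutting the Green integral at `t` gives the two integrals of `mapH`. The integrability that
permits the cut holds for every candidate in the weighted space, so it is available in both
directions. -/
theorem isFixedPointH_iff [CompleteSpace X] (G : GapCondition L Q M γ ρ Γ L₁ L₂ σ)
    (hg : IsSplitNonlinearity L Q γ ρ Γ L₁ L₂ g) {η : X} {z : ℝ → X} :
    IsFixedPointH L Q γ ρ Γ g σ τ η z ↔ IsMildSolution L Q γ ρ Γ g σ τ η z := by
  have key : ContinuousOn z (Iic τ) → (∃ B, ExpBounded L Q γ ρ Γ σ τ B z) → ∀ t ≤ τ,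
      mapH L Q g τ η z t =
        unstableOp L Q t τ η + greenIntegral L Q τ (fun s => g s (z s)) t := fun hz hb t ht => by
    have hw := G.weightedIntegrable hg G.right hz hb
    rw [G.split.greenIntegral_eq G.process G.le_gamma le_rfl hw ht, mapH,
      intervalIntegral.integral_of_le ht, G.split.unstableOp_apply ht,
      setIntegral_congr_fun (f := fun s => unstableOp L Q t s (g s (z s))) measurableSet_Ioc
        (fun s hst => G.split.unstableOp_apply (mem_Ioc.1 hst).1.le (g s (z s))),
      sub_eq_add_neg, add_assoc]
    simp only [stableIntegrand, stableOp_apply]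
  rw [IsFixedPointH, memE_iff]
  constructor
  · rintro ⟨⟨h1, h2⟩, h3⟩
    exact ⟨h1, h2, fun t ht => (h3 ht).trans (key h1 h2 t ht)⟩
  · rintro ⟨h1, h2, h3⟩
    exact ⟨⟨h1, h2⟩, fun t ht => (h3 t ht).trans (key h1 h2 t ht).symm⟩

theorem integrableOn_stableIntegrand [CompleteSpace X] (G : GapCondition L Q M γ ρ Γ L₁ L₂ σ)
    (hg : IsSplitNonlinearity L Q γ ρ Γ L₁ L₂ g) {η : X} {z : ℝ → X}
    (hz : IsMildSolution L Q γ ρ Γ g σ τ η z) {t : ℝ} (ht : t ≤ τ) :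
    IntegrableOn (stableIntegrand L Q g z t) (Iic t) := by
  have h := G.split.integrableOn_stableOp G.process G.le_gamma le_rfl
    (G.weightedIntegrable hg G.right hz.cont hz.bdd) ht
  simp only [stableOp_apply] at h
  exact h

end GapCondition

/-! ### Global solutions and the invariant manifold -/

theorem isSplitNonlinearity_of_continuous (hf : Continuous fun p : ℝ × X => f p.1 p.2)
    (hf0 : ∀ t, f t 0 = 0) (hLip : IsSplitLipschitz L Q γ ρ Γ f L₁ L₂) :
    IsSplitNonlinearity L Q γ ρ Γ L₁ L₂ f where
  lip := hLip
  zero := hf0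
  meas _ hz := (hf.comp (continuous_id.prodMk hz)).aestronglyMeasurable

/-- The integral form of Gronwall's lemma, with vanishing initial value. -/
theorem eq_zero_of_le_mul_integral {d : ℝ → ℝ} (hd : Continuous d) (hd0 : ∀ t, 0 ≤ d t)
    {a b C : ℝ} (h : ∀ t ∈ Icc a b, d t ≤ C * ∫ s in a..t, d s) : ∀ t ∈ Icc a b, d t = 0 := by
  have hder : ∀ t, HasDerivAt (fun t => ∫ s in a..t, d s) (d t) t := fun t =>
    intervalIntegral.integral_hasDerivAt_right (hd.intervalIntegrable _ _)
      hd.aestronglyMeasurable.stronglyMeasurableAtFilter hd.continuousAt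
  have hg := norm_le_gronwallBound_of_norm_deriv_right_le (f := fun t => ∫ s in a..t, d s)
    (f' := d) (δ := 0) (K := C) (ε := 0) (a := a) (b := b)
    (fun t _ => (hder t).continuousAt.continuousWithinAt)
    (fun t _ => (hder t).hasDerivWithinAt) (by simp) (fun t ht => by
      have h0 : 0 ≤ ∫ s in a..t, d s := intervalIntegral.integral_nonneg ht.1 fun s _ => hd0 s
      rw [Real.norm_of_nonneg (hd0 t), Real.norm_of_nonneg h0, add_zero]
      exact h t ⟨ht.1, ht.2.le⟩)
  intro t ht
  have := hg t ht
  rw [gronwallBound_ε0_δ0, norm_le_zero_iff] at this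
  refine le_antisymm ((h t ht).trans ?_) (hd0 t)
  rw [this, mul_zero]

theorem IsLinearEvolutionProcess.intervalIntegrable_forward [CompleteSpace X]
    (hL : IsLinearEvolutionProcess L) {r t : ℝ} (hrt : r ≤ t) {q : ℝ → X}
    (hq : ContinuousOn q (Icc r t)) :
    IntervalIntegrable (fun s => L t s (q s)) volume r t := by
  refine ContinuousOn.intervalIntegrable ?_
  rw [uIcc_of_le hrt]
  have h : ContinuousOn (fun s => L (max t s) (min t s) (q s)) (Icc r t) :=
    hL.continuous_forward.comp_continuousOn (f := fun s => ((t, s), q s)) (by fun_prop)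
  refine h.congr fun s hst => ?_
  simp only [max_eq_left hst.2, min_eq_right hst.2]

/-- Uniqueness for the variation of constants formula. -/
theorem eqOn_of_forward [CompleteSpace X] (hL : IsLinearEvolutionProcess L)
    (hf : Continuous fun p : ℝ × X => f p.1 p.2) {K : ℝ}
    (hK : ∀ t u v, ‖f t u - f t v‖ ≤ K * ‖u - v‖) {r b : ℝ} (hrb : r ≤ b) {u v : ℝ → X}
    (hu : ContinuousOn u (Icc r b)) (hv : ContinuousOn v (Icc r b)) {x : X}
    (hue : ∀ t ∈ Icc r b, u t = L t r x + ∫ s in r..t, L t s (f s (u s)))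
    (hve : ∀ t ∈ Icc r b, v t = L t r x + ∫ s in r..t, L t s (f s (v s))) :
    EqOn u v (Icc r b) := by
  obtain ⟨C, hC0, hC⟩ := exists_bound_of_strong_continuousOn
    (A := fun p : ℝ × ℝ => L (max p.1 p.2) (min p.1 p.2))
    (fun x => hL.continuous_forward.comp (f := fun p => (p, x)) (by fun_prop))
    (isCompact_Icc.prod isCompact_Icc : IsCompact (Icc r b ×ˢ Icc r b))
  have hCL : ∀ t ∈ Icc r b, ∀ s ∈ Icc r t, ‖L t s‖ ≤ C := fun t ht s hst => by
    have := hC (t, s) ⟨ht, hst.1, hst.2.trans ht.2⟩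
    simpa only [max_eq_left hst.2, min_eq_right hst.2] using this
  -- Clamping to `[r, b]` makes the difference continuous on the whole line, as the Gronwall lemma
  -- requires.
  let p : ℝ → ℝ := fun t => max r (min t b)
  have hpc : Continuous p := by fun_prop
  have hp : ∀ t, p t ∈ Icc r b := fun t => ⟨le_max_left _ _, max_le hrb (min_le_right _ _)⟩
  have hp' : ∀ t ∈ Icc r b, p t = t := fun t ht => by
    simp only [p, min_eq_left ht.2, max_eq_right ht.1]
  let d : ℝ → ℝ := fun t => ‖u (p t) - v (p t)‖
  have hd : Continuous d :=
    ((hu.comp_continuous hpc hp).sub (hv.comp_continuous hpc hp)).norm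
  have hfc : ∀ {w : ℝ → X}, ContinuousOn w (Icc r b) → ∀ t ∈ Icc r b,
      IntervalIntegrable (fun s => L t s (f s (w s))) volume r t := fun hw t ht =>
    hL.intervalIntegrable_forward ht.1 (hf.comp_continuousOn
      (continuousOn_id.prodMk (hw.mono (Icc_subset_Icc_right ht.2))))
  have hmain := eq_zero_of_le_mul_integral hd (fun t => norm_nonneg _) (a := r) (b := b)
    (C := C * K) fun t ht => by
      simp only [d, hp' t ht]
      rw [hue t ht, hve t ht, add_sub_add_left_eq_sub,
        ← intervalIntegral.integral_sub (hfc hu t ht) (hfc hv t ht),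
        ← intervalIntegral.integral_const_mul]
      refine intervalIntegral.norm_integral_le_of_norm_le ht.1
        (Eventually.of_forall fun s hst => ?_)
        ((continuous_const.mul hd).intervalIntegrable _ _)
      have hs' : s ∈ Icc r t := ⟨hst.1.le, hst.2⟩
      rw [← map_sub, hp' s ⟨hst.1.le, hst.2.trans ht.2⟩, mul_assoc]
      exact ((L t s).le_opNorm _).trans
        (mul_le_mul (hCL t ht s hs') (hK s _ _) (norm_nonneg _) hC0)
  intro t ht
  have := hmain t ht
  simp only [d, hp' t ht, norm_eq_zero] at this
  exact sub_eq_zero.1 this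

theorem IsGlobalSolution.continuous (hT : IsEvolutionProcess T) {z : ℝ → X}
    (hz : IsGlobalSolution T z) : Continuous z := by
  rw [continuous_iff_continuousAt]
  intro t
  have h : ContinuousOn z (Ici (t - 1)) :=
    (hT.cont (t - 1) (z (t - 1))).congr fun s hst => (hz (t - 1) s hst).symm
  exact h.continuousAt (Ici_mem_nhds (by linarith))

theorem IsGlobalSolution.eq_forward (hVCF : SatisfiesVCF L f T) {z : ℝ → X}
    (hz : IsGlobalSolution T z) {r t : ℝ} (h : r ≤ t) :
    z t = L t r (z r) + ∫ s in r..t, L t s (f s (z s)) := by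
  conv_lhs => rw [← hz r t h, hVCF r t h]
  congr 1
  refine intervalIntegral.integral_congr fun s hst => ?_
  rw [uIcc_of_le h] at hst
  simp only [hz r s hst.1]

theorem bddAbove_iff_expBounded {z : ℝ → X} {t : ℝ} :
    BddAbove ((fun r => Real.exp (σ * r) * movingNorm L Q γ ρ Γ r (z r)) '' Iic t) ↔
      ∃ B, ExpBounded L Q γ ρ Γ σ t B z := by
  have hexp : ∀ r, Real.exp (-(σ * (r - t))) = Real.exp (σ * t) * (Real.exp (σ * r))⁻¹ :=
    fun r => by rw [← Real.exp_neg, ← Real.exp_add]; congr 1; ring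
  constructor
  · rintro ⟨B, hB⟩
    refine ⟨B * Real.exp (-(σ * t)), fun r hr => ?_⟩
    have := hB ⟨r, hr, rfl⟩
    rw [hexp, mul_assoc, ← mul_assoc (Real.exp _) (Real.exp _), ← Real.exp_add, neg_add_cancel,
      Real.exp_zero, one_mul, ← div_eq_mul_inv, le_div_iff₀ (Real.exp_pos _), mul_comm]
    exact this
  · rintro ⟨B, hB⟩
    refine ⟨B * Real.exp (σ * t), ?_⟩
    rintro _ ⟨r, hr, rfl⟩
    have := hB r hr
    rwa [hexp, ← mul_assoc, ← div_eq_mul_inv, le_div_iff₀ (Real.exp_pos _), mul_comm] at this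

namespace GapCondition

/-- A global solution with the growth of `E_{σ,τ}` is a mild solution. -/
theorem isMildSolution_of_isGlobalSolution [CompleteSpace X]
    (G : GapCondition L Q M γ ρ Γ L₁ L₂ σ) (hf : IsSplitNonlinearity L Q γ ρ Γ L₁ L₂ f)
    (hT : IsEvolutionProcess T) (hVCF : SatisfiesVCF L f T) {z : ℝ → X}
    (hz : IsGlobalSolution T z) (hb : ∃ B, ExpBounded L Q γ ρ Γ σ τ B z) :
    IsMildSolution L Q γ ρ Γ f σ τ (z τ) z := by
  have hL := G.process
  have hs := G.split
  have hzc : ContinuousOn z (Iic τ) := (hz.continuous hT).continuousOn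
  obtain ⟨B, hB⟩ := hb
  have hB0 := hB.nonneg G.norm
  have hw := G.weightedIntegrable hf G.right hzc ⟨B, hB⟩
  refine ⟨hzc, ⟨B, hB⟩, fun r hr => ?_⟩
  set J := greenIntegral L Q τ fun s => f s (z s) with hJ
  -- Both `z` and `J` satisfy the inhomogeneous formula with the same forcing, so the difference is
  -- a homogeneous linear orbit.
  have hfw : ∀ s t, s ≤ t → t ≤ τ → z t - J t = L t s (z s - J s) := fun s t hst ht => by
    rw [hJ, hs.greenIntegral_eq_forward hL G.le_gamma le_rfl hw hst ht, hz.eq_forward hVCF hst,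
      map_sub, add_sub_add_right_eq_sub]
  obtain ⟨c, hc, hc1, -⟩ := hs.exists_movingNorm_equiv hL G.norm
  have hJB : ExpBounded L Q γ ρ Γ σ τ (Γ (B * L₁ / (σ - ρ), B * L₂ / (γ - σ))) J := fun t ht => by
    have h1 := G.nonneg₁
    have h2 := G.nonneg₂
    have hlip := fun s => hf.lip s (z s) 0
    simp only [hf.zero, sub_zero] at hlip
    refine hs.movingNorm_greenIntegral_le hL G.norm G.le_gamma le_rfl G.left G.right hw
      (by positivity) (fun s hst => (hlip s).1.trans ?_) (fun s hst => (hlip s).2.trans ?_) ht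
    · rw [mul_comm B, mul_assoc]
      exact mul_le_mul_of_nonneg_left (hB s hst) h1
    · rw [mul_comm B, mul_assoc]
      exact mul_le_mul_of_nonneg_left (hB s hst) h2
  have hwB := hB.sub hs G.norm hJB
  set D := B + Γ (B * L₁ / (σ - ρ), B * L₂ / (γ - σ))
  -- Starting the orbit at `s` and letting `s → -∞`, the decay rate `γ` beats the growth rate `σ`,
  -- so the stable component must vanish.
  have hstab : z r - J r - Q r (z r - J r) = 0 := by
    have hle : ∀ s ≤ r, ‖z r - J r - Q r (z r - J r)‖ ≤
        M * c * D * Real.exp (σ * τ - γ * r) * Real.exp ((γ - σ) * s) := fun s hsr => by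
      have h1 : z r - J r - Q r (z r - J r) = stableOp L Q r s (z s - J s) := by
        rw [stableOp_apply, map_sub (L r s), ← hs.comm_apply hsr, ← hfw s r hsr hr]
      have h2 := (hc1 s _).trans (mul_le_mul_of_nonneg_left (hwB s (hsr.trans hr)) hc.le)
      rw [h1]
      have hM := hs.M_pos
      calc ‖stableOp L Q r s (z s - J s)‖
          ≤ M * Real.exp (-(γ * (r - s))) * ‖z s - J s‖ := hs.norm_stableOp_apply_le hsr _
        _ ≤ M * Real.exp (-(γ * (r - s))) * (c * (D * Real.exp (-(σ * (s - τ))))) := by gcongr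
        _ = M * c * D * Real.exp (-(γ * (r - s)) + -(σ * (s - τ))) := by rw [Real.exp_add]; ring
        _ = M * c * D * Real.exp ((σ * τ - γ * r) + (γ - σ) * s) := by congr 2; ring
        _ = _ := by rw [Real.exp_add]; ring
    have hlim : Tendsto (fun s => M * c * D * Real.exp (σ * τ - γ * r) * Real.exp ((γ - σ) * s))
        atBot (𝓝 0) := by
      have h1 : Tendsto (fun s : ℝ => Real.exp ((γ - σ) * s)) atBot (𝓝 0) :=
        Real.tendsto_exp_atBot.comp
          (tendsto_id.const_mul_atBot (show 0 < γ - σ by linarith [G.right]))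
      simpa using h1.const_mul (M * c * D * Real.exp (σ * τ - γ * r))
    refine norm_le_zero_iff.1 (ge_of_tendsto hlim ?_)
    filter_upwards [Iic_mem_atBot r] with s hsr using hle s hsr
  -- Pulling the orbit back from `τ` identifies its unstable part; `J` contributes nothing there,
  -- having no unstable component at `τ`.
  have hunst : unstableOp L Q r τ (z τ) = Q r (z r - J r) := by
    have h1 := hs.unstableOp_greenIntegral hL G.le_gamma le_rfl hw hr (le_refl τ)
    rw [Ioc_self, setIntegral_empty, neg_zero] at h1
    have h2 : unstableOp L Q r τ (z τ - J τ) = Q r (z r - J r) := by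
      rw [hfw r τ hr le_rfl, hs.unstableOp_forward hL le_rfl hr, hs.unstableOp_self hL]
    rw [← h2, map_sub, hJ, h1, sub_zero]
  rw [hunst, ← sub_eq_zero.1 hstab, sub_add_cancel]

/-- Mild solutions solve the nonlinear equation forward in time. -/
theorem forward_mildSolution [CompleteSpace X] (G : GapCondition L Q M γ ρ Γ L₁ L₂ σ)
    (hf : Continuous fun p : ℝ × X => f p.1 p.2) (hg : IsSplitNonlinearity L Q γ ρ Γ L₁ L₂ f)
    (hT : IsEvolutionProcess T) (hVCF : SatisfiesVCF L f T) {η : X} {z : ℝ → X}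
    (hz : IsMildSolution L Q γ ρ Γ f σ τ η z) {r t : ℝ} (hrt : r ≤ t) (ht : t ≤ τ) :
    T t r (z r) = z t := by
  have hL := G.process
  have hs := G.split
  obtain ⟨c, hc, -, hc2⟩ := hs.exists_movingNorm_equiv hL G.norm
  have hw := G.weightedIntegrable hg G.right hz.cont hz.bdd
  have hLip : ∀ t u v, ‖f t u - f t v‖ ≤ (L₁ + L₂) * c * ‖u - v‖ := fun t u v => by
    have h1 := G.nonneg₁
    have h2 := G.nonneg₂
    rw [mul_assoc]
    exact (hs.norm_sub_le_of_lip hL hg.lip t u v).trans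
      (mul_le_mul_of_nonneg_left (hc2 _ _) (by positivity))
  refine eqOn_of_forward hL hf hLip hrt (u := fun t => T t r (z r)) (v := z) (x := z r)
    ((hT.cont r (z r)).mono Icc_subset_Ici_self)
    (hz.cont.mono fun s hst => hst.2.trans ht) (fun s hst => hVCF r s hst.1 _)
    (fun s hst => ?_) ⟨hrt, le_rfl⟩
  have hsτ : s ≤ τ := hst.2.trans ht
  rw [hz.eq s hsτ, hs.greenIntegral_eq_forward hL G.le_gamma le_rfl hw hst.1 hsτ,
    hz.eq r (hst.1.trans hsτ), map_add, hs.forward_unstableOp_of_le hL hst.1 hsτ, add_assoc]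

/-- A mild solution extends to a global solution. -/
theorem mildSolution_mem_manifold [CompleteSpace X] (G : GapCondition L Q M γ ρ Γ L₁ L₂ σ)
    (hf : Continuous fun p : ℝ × X => f p.1 p.2) (hg : IsSplitNonlinearity L Q γ ρ Γ L₁ L₂ f)
    (hT : IsEvolutionProcess T) (hVCF : SatisfiesVCF L f T) {η : X} {z : ℝ → X}
    (hz : IsMildSolution L Q γ ρ Γ f σ τ η z) : z τ ∈ manifold L Q γ ρ Γ T σ τ := by
  have hfw := fun r t hrt ht => G.forward_mildSolution hf hg hT hVCF hz (r := r) (t := t) hrt ht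
  refine ⟨fun s => if s ≤ τ then z s else T s τ (z τ), fun r t hrt => ?_, by simp, ?_⟩
  · by_cases h1 : t ≤ τ
    · simp only [if_pos (hrt.trans h1), if_pos h1, hfw r t hrt h1]
    · have h1' := (not_le.1 h1).le
      by_cases h2 : r ≤ τ
      · simp only [if_neg h1, if_pos h2]
        rw [← hfw r τ h2 le_rfl, hT.comp r τ t h2 h1']
      · simp only [if_neg h1, if_neg h2]
        rw [hT.comp τ r t (not_le.1 h2).le hrt]
  · rw [bddAbove_iff_expBounded]
    obtain ⟨B, hB⟩ := hz.bdd
    exact ⟨B, fun t ht => by simpa only [if_pos ht] using hB t ht⟩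

/-- The invariant manifold is a graph over the unstable subspace. -/
theorem manifold_eq_range [CompleteSpace X] (G : GapCondition L Q M γ ρ Γ L₁ L₂ σ)
    (hf : Continuous fun p : ℝ × X => f p.1 p.2) (hg : IsSplitNonlinearity L Q γ ρ Γ L₁ L₂ f)
    (hT : IsEvolutionProcess T) (hVCF : SatisfiesVCF L f T) {z : X → ℝ → X}
    (hz : ∀ η, IsMildSolution L Q γ ρ Γ f σ τ η (z η)) :
    manifold L Q γ ρ Γ T σ τ =
      range fun η : X => Q τ η + (z (Q τ η) τ - Q τ (z (Q τ η) τ)) := by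
  ext x
  constructor
  · rintro ⟨w, hw, rfl, hb⟩
    have h := G.isMildSolution_of_isGlobalSolution hg hT hVCF hw (bddAbove_iff_expBounded.1 hb)
    have h2 := G.mildSolution_unique hg (hz (Q τ (w τ))) (G.mildSolution_proj_iff.2 h) self_mem_Iic
    exact ⟨w τ, by simp only [h2, add_sub_cancel]⟩
  · rintro ⟨η, rfl⟩
    have h := G.proj_mildSolution hg (hz (Q τ η))
    rw [G.split.proj_apply] at h
    simp only [h, add_sub_cancel]
    exact G.mildSolution_mem_manifold hf hg hT hVCF (hz _)

/-- The same global solution serves at both times. Going forward, the growth bound has to be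
extended only over the compact interval `[τ, t]`, where continuity suffices; going back, it is
restricted. -/
theorem image_manifold [CompleteSpace X] (G : GapCondition L Q M γ ρ Γ L₁ L₂ σ)
    (hT : IsEvolutionProcess T) {t : ℝ} (ht : τ ≤ t) :
    T t τ '' manifold L Q γ ρ Γ T σ τ = manifold L Q γ ρ Γ T σ t := by
  ext x
  constructor
  · rintro ⟨_, ⟨z, hz, rfl, hb⟩, rfl⟩
    refine ⟨z, hz, (hz τ t ht).symm, ?_⟩
    obtain ⟨c, hc, -, hc2⟩ := G.split.exists_movingNorm_equiv G.process G.norm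
    have hzc := hz.continuous hT
    obtain ⟨C, hC⟩ := isCompact_Icc.bddAbove_image (K := Icc τ t)
      (f := fun r => Real.exp (σ * r) * (c * ‖z r‖)) (by fun_prop)
    rw [← Iic_union_Icc_eq_Iic ht, image_union, bddAbove_union]
    refine ⟨hb, C, ?_⟩
    rintro _ ⟨r, hr, rfl⟩
    exact (mul_le_mul_of_nonneg_left (hc2 r (z r)) (Real.exp_pos _).le).trans (hC ⟨r, hr, rfl⟩)
  · rintro ⟨z, hz, rfl, hb⟩
    exact ⟨z τ, ⟨z, hz, rfl, hb.mono (image_mono (Iic_subset_Iic.2 ht))⟩, hz τ t ht⟩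

end GapCondition

end

section

variable {𝕜 : Type*} [RCLike 𝕜]
variable {X : Type*} [NormedAddCommGroup X] [NormedSpace ℝ X] [NormedSpace 𝕜 X]
variable {L : ℝ → ℝ → X →L[𝕜] X} {Q : ℝ → X →L[𝕜] X} {M γ ρ : ℝ} {Γ : ℝ × ℝ → ℝ}
variable {σ τ L₁ L₂ : ℝ} {f : ℝ → X → X}

/-! ### The linearised equation -/

namespace HasExponentialSplitting

/-- Lower semicontinuity of a supremum of continuous functions. It lets bounds on difference
quotients pass to the derivative without loss in the constant. -/
theorem unstableNorm_le_of_tendsto (hs : HasExponentialSplitting L Q M γ ρ) {t a : ℝ}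
    {y : ℕ → X} {x : X} (hy : Tendsto y atTop (𝓝 x))
    (h : ∀ n, unstableNorm L Q ρ t (y n) ≤ a) : unstableNorm L Q ρ t x ≤ a :=
  hs.unstableNorm_le_iff.2 fun r hr =>
    le_of_tendsto ((((unstableOp L Q r t).continuous.tendsto x).comp hy).norm.const_mul _)
      (Eventually.of_forall fun n => hs.unstableNorm_le_iff.1 (h n) r hr)

theorem stableNorm_le_of_tendsto (hs : HasExponentialSplitting L Q M γ ρ) {t a : ℝ}
    {y : ℕ → X} {x : X} (hy : Tendsto y atTop (𝓝 x))
    (h : ∀ n, stableNorm L Q γ t (y n) ≤ a) : stableNorm L Q γ t x ≤ a :=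
  hs.stableNorm_le_iff.2 fun r hr =>
    le_of_tendsto ((((stableOp L Q r t).continuous.tendsto x).comp hy).norm.const_mul _)
      (Eventually.of_forall fun n => hs.stableNorm_le_iff.1 (h n) r hr)

end HasExponentialSplitting

/-- The derivative of the nonlinearity along a continuous curve is again an admissible
nonlinearity, with the same Lipschitz constants. -/
theorem isSplitNonlinearity_fderiv (hs : HasExponentialSplitting L Q M γ ρ)
    (hΓ : IsAdmissibleNorm Γ) (hL₁ : 0 ≤ L₁) (hL₂ : 0 ≤ L₂)
    (hf : Continuous fun p : ℝ × X => f p.1 p.2) (hLip : IsSplitLipschitz L Q γ ρ Γ f L₁ L₂)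
    {Df : ℝ → X → X →L[𝕜] X} (hDf : ∀ t u, HasFDerivAt (f t) (Df t u) u) {z : ℝ → X}
    (hz : Continuous z) :
    IsSplitNonlinearity L Q γ ρ Γ L₁ L₂ fun s u => Df s (z s) u := by
  let c : ℕ → 𝕜 := fun n => ((n + 1 : ℕ) : 𝕜)
  have hcn : ∀ n, ‖c n‖ = ((n + 1 : ℕ) : ℝ) := fun n => RCLike.norm_natCast _
  have hc0 : ∀ n, 0 < ‖c n‖ := fun n => by rw [hcn]; positivity
  have hc : Tendsto (fun n => ‖c n‖) atTop atTop := by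
    simp only [hcn]
    exact tendsto_natCast_atTop_atTop.comp (tendsto_add_atTop_nat 1)
  have hlim : ∀ s u, Tendsto (fun n => c n • (f s (z s + (c n)⁻¹ • u) - f s (z s))) atTop
      (𝓝 (Df s (z s) u)) := fun s u => (hDf s (z s)).lim u hc
  have hmn : ∀ n t w, ‖c n‖ * movingNorm L Q γ ρ Γ t (z t + (c n)⁻¹ • w - z t) ≤
      movingNorm L Q γ ρ Γ t w := fun n t w => by
    rw [add_sub_cancel_left]
    refine (mul_le_mul_of_nonneg_left (hs.movingNorm_smul_le hΓ t _ w) (hc0 n).le).trans ?_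
    rw [norm_inv, mul_inv_cancel_left₀ (hc0 n).ne']
  refine ⟨fun t u v => ?_, fun t => map_zero _, fun w hw => ?_⟩
  · rw [← map_sub]
    constructor
    · refine hs.unstableNorm_le_of_tendsto (hlim t (u - v)) fun n => ?_
      refine (hs.unstableNorm_smul_le t _ _).trans ?_
      refine (mul_le_mul_of_nonneg_left (hLip t _ _).1 (hc0 n).le).trans ?_
      rw [mul_left_comm]
      exact mul_le_mul_of_nonneg_left (hmn n t _) hL₁
    · refine hs.stableNorm_le_of_tendsto (hlim t (u - v)) fun n => ?_
      refine (hs.stableNorm_smul_le t _ _).trans ?_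
      refine (mul_le_mul_of_nonneg_left (hLip t _ _).2 (hc0 n).le).trans ?_
      rw [mul_left_comm]
      exact mul_le_mul_of_nonneg_left (hmn n t _) hL₂
  -- No regularity of `Df` in time is assumed; measurability comes from the pointwise limit of
  -- continuous difference quotients.
  · refine aestronglyMeasurable_of_tendsto_ae atTop (fun n => ?_)
      (Eventually.of_forall fun s => hlim s (w s))
    have h1 : Continuous fun s => f s (z s + (c n)⁻¹ • w s) :=
      hf.comp (f := fun s => (s, z s + (c n)⁻¹ • w s)) (by fun_prop)
    have h2 : Continuous fun s => f s (z s) := hf.comp (f := fun s => (s, z s)) (by fun_prop)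
    exact ((h1.sub h2).const_smul (c n)).aestronglyMeasurable

namespace GapCondition

theorem isMildSolution_zero (G : GapCondition L Q M γ ρ Γ L₁ L₂ σ) {g : ℝ → X → X}
    (hg : IsSplitNonlinearity L Q γ ρ Γ L₁ L₂ g) :
    IsMildSolution L Q γ ρ Γ g σ τ 0 fun _ => 0 where
  cont := continuousOn_const
  bdd := ⟨0, fun t _ => by
    rw [HasExponentialSplitting.movingNorm_zero G.norm G.split, zero_mul]⟩
  eq t _ := by simp [hg.zero, greenIntegral]

section Linear

variable {A : ℝ → X →L[𝕜] X}

theorem isMildSolution_add [CompleteSpace X] (G : GapCondition L Q M γ ρ Γ L₁ L₂ σ)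
    (hA : IsSplitNonlinearity L Q γ ρ Γ L₁ L₂ fun s u => A s u) {h k : X} {v w : ℝ → X}
    (hv : IsMildSolution L Q γ ρ Γ (fun s u => A s u) σ τ h v)
    (hw : IsMildSolution L Q γ ρ Γ (fun s u => A s u) σ τ k w) :
    IsMildSolution L Q γ ρ Γ (fun s u => A s u) σ τ (h + k) fun t => v t + w t where
  cont := hv.cont.add hw.cont
  bdd := by
    obtain ⟨B, hB⟩ := hv.bdd
    obtain ⟨C, hC⟩ := hw.bdd
    exact ⟨_, hB.add G.split G.norm hC⟩
  eq t ht := by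
    simp only [map_add]
    rw [G.split.greenIntegral_add G.process G.le_gamma le_rfl
      (G.weightedIntegrable hA G.right hv.cont hv.bdd)
      (G.weightedIntegrable hA G.right hw.cont hw.bdd), hv.eq t ht, hw.eq t ht]
    abel

theorem isMildSolution_smul (G : GapCondition L Q M γ ρ Γ L₁ L₂ σ) (c : 𝕜) {h : X} {v : ℝ → X}
    (hv : IsMildSolution L Q γ ρ Γ (fun s u => A s u) σ τ h v) :
    IsMildSolution L Q γ ρ Γ (fun s u => A s u) σ τ (c • h) fun t => c • v t where
  cont := hv.cont.const_smul c
  bdd := by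
    obtain ⟨B, hB⟩ := hv.bdd
    exact ⟨_, hB.smul G.split G.norm c⟩
  eq t ht := by
    simp only [map_smul]
    rw [HasExponentialSplitting.greenIntegral_smul, hv.eq t ht, smul_add]

/-- The terminal value of the solution of a linear equation is a bounded linear function of
its datum. -/
theorem exists_terminalValue [CompleteSpace X] (G : GapCondition L Q M γ ρ Γ L₁ L₂ σ)
    (hA : IsSplitNonlinearity L Q γ ρ Γ L₁ L₂ fun s u => A s u) (τ : ℝ) :
    ∃ E : X →L[𝕜] X, ∀ h v, IsMildSolution L Q γ ρ Γ (fun s u => A s u) σ τ h v → E h = v τ := by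
  choose v _ hv using G.exists_mildSolution hA τ
  obtain ⟨C, -, hC⟩ := G.exists_lipschitz_const
  have huniq : ∀ {h w}, IsMildSolution L Q γ ρ Γ (fun s u => A s u) σ τ h w → v h τ = w τ :=
    fun hw => G.mildSolution_unique hA (hv _) hw self_mem_Iic
  refine ⟨LinearMap.mkContinuous
    { toFun := fun h => v h τ
      map_add' := fun h k => huniq (G.isMildSolution_add hA (hv h) (hv k))
      map_smul' := fun c h => huniq (G.isMildSolution_smul c (hv h)) } C fun h => ?_,
    fun h w hw => huniq hw⟩
  simpa using hC _ hA τ h 0 _ _ (hv h) (G.isMildSolution_zero hA) τ le_rfl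

/-- Solutions of the linear equation with zero datum are controlled by the inhomogeneity. -/
theorem exists_forced_const [CompleteSpace X] (G : GapCondition L Q M γ ρ Γ L₁ L₂ σ) :
    ∃ C, 0 ≤ C ∧ ∀ (A : ℝ → X →L[𝕜] X),
      (IsSplitNonlinearity L Q γ ρ Γ L₁ L₂ fun s u => A s u) →
      ∀ (τ : ℝ) (w r : ℝ → X), ContinuousOn w (Iic τ) → (∃ B, ExpBounded L Q γ ρ Γ σ τ B w) →
        WeightedIntegrable σ τ r →
        (∀ t ≤ τ, w t = greenIntegral L Q τ (fun s => A s (w s)) t + greenIntegral L Q τ r t) →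
        ‖w τ‖ ≤ C * ∫ s in Iic τ, Real.exp (σ * (s - τ)) * ‖r s‖ := by
  obtain ⟨c, hc, hc1, hc2⟩ := G.split.exists_movingNorm_equiv G.process G.norm
  have hκ := G.gap
  set κ := Γ (L₁ / (σ - ρ), L₂ / (γ - σ)) with hκd
  have hM := G.split.M_pos
  refine ⟨c * (c * M / (1 - κ)), mul_nonneg hc.le (div_nonneg (by positivity) (by linarith)),
    fun A hA τ w r hw hb hr he => ?_⟩
  obtain ⟨B, hB⟩ := hb
  have hlip := fun s => hA.lip s (w s) 0
  simp only [map_zero, sub_zero] at hlip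
  have h := G.split.expBounded_of_forced G.process G.norm G.left G.right G.nonneg₁ G.gap
    G.le_gamma le_rfl (G.weightedIntegrable hA G.right hw ⟨B, hB⟩) hB (fun s _ => (hlip s).1)
    (fun s _ => (hlip s).2) G.nonneg₂
    -- The inhomogeneity is measured by its weighted `L¹` norm, not by a supremum, so that dominated
    -- convergence can make it small.
    (D := c * (M * ∫ s in Iic τ, Real.exp (σ * (s - τ)) * ‖r s‖))
    (HasExponentialSplitting.expBounded_of_norm hc hc2 fun t ht => by
      rw [he t ht, add_sub_cancel_left]
      exact G.split.norm_greenIntegral_le G.left.le G.right.le hr t) τ le_rfl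
  rw [sub_self, mul_zero, neg_zero, Real.exp_zero, mul_one] at h
  refine ((hc1 τ _).trans (mul_le_mul_of_nonneg_left h hc.le)).trans (le_of_eq ?_)
  rw [← hκd]
  ring

end Linear

/-- One constant, independent of `g`, serves for `f` and for its linearisations along all
trajectories. -/
theorem exists_lipschitz_norm (G : GapCondition L Q M γ ρ Γ L₁ L₂ σ) :
    ∃ K, 0 ≤ K ∧ ∀ g, IsSplitLipschitz L Q γ ρ Γ g L₁ L₂ →
      ∀ t u v, ‖g t u - g t v‖ ≤ K * ‖u - v‖ := by
  obtain ⟨c, hc, -, hc2⟩ := G.split.exists_movingNorm_equiv G.process G.norm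
  have h1 := G.nonneg₁
  have h2 := G.nonneg₂
  refine ⟨(L₁ + L₂) * c, by positivity, fun g hg t u v => ?_⟩
  rw [mul_assoc]
  exact (G.split.norm_sub_le_of_lip G.process hg t u v).trans
    (mul_le_mul_of_nonneg_left (hc2 _ _) (by positivity))

end GapCondition

theorem integrableOn_exp_mul_sub {a : ℝ} (ha : 0 < a) (τ : ℝ) :
    IntegrableOn (fun s => Real.exp (a * (s - τ))) (Iic τ) := by
  refine ((integrableOn_exp_mul_Iic ha τ).const_mul (Real.exp (-(a * τ)))).congr
    (Eventually.of_forall fun s => ?_)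
  simp only
  rw [← Real.exp_add]
  congr 1
  ring

/-- Dominated convergence with majorant `C e^{(σ'-σ)(s-τ)}`. The strict inequality `σ < σ'` replaces
any uniformity in `s` of the pointwise limit. -/
theorem tendsto_weighted_integral_zero {α : Type*} {l : Filter α} [l.IsCountablyGenerated]
    {σ σ' τ C : ℝ} (hσ : σ < σ') {F : α → ℝ → ℝ} (hF0 : ∀ a s, 0 ≤ F a s)
    (hmeas : ∀ a, AEStronglyMeasurable (F a) (volume.restrict (Iic τ)))
    (hbound : ∀ a, ∀ s ≤ τ, F a s ≤ C * Real.exp (-(σ * (s - τ))))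
    (hlim : ∀ s ≤ τ, Tendsto (fun a => F a s) l (𝓝 0)) :
    Tendsto (fun a => ∫ s in Iic τ, Real.exp (σ' * (s - τ)) * F a s) l (𝓝 0) := by
  have h := tendsto_integral_filter_of_dominated_convergence (μ := volume.restrict (Iic τ))
    (F := fun a s => Real.exp (σ' * (s - τ)) * F a s) (f := fun _ => (0 : ℝ)) (l := l)
    (fun s => C * Real.exp ((σ' - σ) * (s - τ)))
    (Eventually.of_forall fun a =>
      (show Continuous fun s => Real.exp (σ' * (s - τ)) by fun_prop).aestronglyMeasurable.mul
        (hmeas a))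
    (Eventually.of_forall fun a => (ae_restrict_iff' measurableSet_Iic).2
      (Eventually.of_forall fun s hs => by
        rw [Real.norm_of_nonneg (mul_nonneg (Real.exp_pos _).le (hF0 a s))]
        refine (mul_le_mul_of_nonneg_left (hbound a s hs) (Real.exp_pos _).le).trans (le_of_eq ?_)
        rw [mul_left_comm, ← Real.exp_add]
        congr 2
        ring))
    ((integrableOn_exp_mul_sub (sub_pos.2 hσ) τ).const_mul C)
    ((ae_restrict_iff' measurableSet_Iic).2 (Eventually.of_forall fun s hs => by
      simpa using (hlim s hs).const_mul (Real.exp (σ' * (s - τ)))))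
  simpa using h

/-! ### Differentiability with respect to the datum -/

namespace GapCondition

variable {Df : ℝ → X → X →L[𝕜] X} {z : X → ℝ → X}

/-- The error `z x - z η - v (x - η)` solves the linearised equation with zero datum, forced by the
first-order remainder `r x` of `f`. After division by `‖x - η‖` this remainder is dominated by
`e^{-σ(s-τ)}` and tends to zero for each `s`, so the forced estimate at `σ' > σ` applies. -/
theorem hasFDerivAt_mildSolution [CompleteSpace X] (G : GapCondition L Q M γ ρ Γ L₁ L₂ σ)
    (hf : Continuous fun p : ℝ × X => f p.1 p.2) (hg : IsSplitNonlinearity L Q γ ρ Γ L₁ L₂ f)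
    (hDf : ∀ t u, HasFDerivAt (f t) (Df t u) u) (hzc : ∀ η, Continuous (z η))
    (hz : ∀ η, IsMildSolution L Q γ ρ Γ f σ τ η (z η)) {η : X} {E : X →L[𝕜] X}
    (hE : ∀ h v, IsMildSolution L Q γ ρ Γ (fun s u => Df s (z η s) u) σ τ h v → E h = v τ) :
    HasFDerivAt (fun η => z η τ) E η := by
  have hL := G.process
  have hs := G.split
  obtain ⟨σ', hσ, G'⟩ := G.exists_larger
  have hA := isSplitNonlinearity_fderiv hs G.norm G.nonneg₁ G.nonneg₂ hf hg.lip hDf (hzc η)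
  set A : ℝ → X →L[𝕜] X := fun s => Df s (z η s)
  obtain ⟨C, hC0, hC⟩ := G.exists_lipschitz_const
  obtain ⟨K, hK0, hK⟩ := G.exists_lipschitz_norm
  obtain ⟨C', hC'0, hC'⟩ := G'.exists_forced_const
  choose v _ hv using G.exists_mildSolution hA τ
  let Δ : X → ℝ → X := fun x s => z x s - z η s
  have hΔ : ∀ x, ∀ s ≤ τ, ‖Δ x s‖ ≤ C * ‖x - η‖ * Real.exp (-(σ * (s - τ))) := fun x s hst =>
    hC f hg τ x η _ _ (hz x) (hz η) s hst
  let r : X → ℝ → X := fun x s => f s (z x s) - f s (z η s) - A s (Δ x s)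
  have hrm : ∀ x, AEStronglyMeasurable (r x) volume := fun x =>
    ((hg.meas _ (hzc x)).sub (hg.meas _ (hzc η))).sub (hA.meas _ ((hzc x).sub (hzc η)))
  have hr : ∀ x, ∀ s ≤ τ, ‖r x s‖ ≤
      2 * K * C * ‖x - η‖ * Real.exp (-(σ * (s - τ))) := fun x s hst => by
    have h1 := hK f hg.lip s (z x s) (z η s)
    have h2 := hK _ hA.lip s (Δ x s) 0
    simp only [map_zero, sub_zero] at h2
    have h3 := mul_le_mul_of_nonneg_left (hΔ x s hst) hK0
    have h4 := norm_sub_le (f s (z x s) - f s (z η s)) (A s (Δ x s))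
    change ‖_‖ ≤ K * ‖Δ x s‖ at h1
    calc ‖r x s‖ ≤ K * ‖Δ x s‖ + K * ‖Δ x s‖ := h4.trans (add_le_add h1 h2)
      _ ≤ _ := (add_le_add h3 h3).trans (le_of_eq (by ring))
  have hmain : ∀ x, ‖z x τ - z η τ - E (x - η)‖ ≤
      C' * ∫ s in Iic τ, Real.exp (σ' * (s - τ)) * ‖r x s‖ := fun x => by
    have hv' := hv (x - η)
    rw [hE _ _ hv']
    obtain ⟨B₁, hB₁⟩ := (hz x).bdd
    obtain ⟨B₂, hB₂⟩ := (hz η).bdd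
    obtain ⟨B₃, hB₃⟩ := hv'.bdd
    have hwb := (hB₁.sub hs G.norm hB₂).sub hs G.norm hB₃
    have hwc := ((hz x).cont.sub (hz η).cont).sub hv'.cont
    have i1 := G.weightedIntegrable hg hσ (hz x).cont (hz x).bdd
    have i2 := G.weightedIntegrable hg hσ (hz η).cont (hz η).bdd
    have i3 : WeightedIntegrable σ' τ fun s => A s (v (x - η) s) :=
      G.weightedIntegrable hA hσ hv'.cont hv'.bdd
    have i4 : WeightedIntegrable σ' τ fun s => A s (z x s - z η s - v (x - η) s) :=
      G.weightedIntegrable hA hσ hwc ⟨_, hwb⟩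
    have i5 : WeightedIntegrable σ' τ (r x) :=
      weightedIntegrable_of_norm_le hσ (hrm x).restrict (hr x)
    have i12 : WeightedIntegrable σ' τ fun s => f s (z x s) - f s (z η s) := by
      simpa [sub_eq_add_neg] using i1.add (i2.smul (-1 : 𝕜))
    refine hC' A hA τ (fun s => z x s - z η s - v (x - η) s) (r x) hwc
      ⟨_, hwb.mono_exponent G.norm hσ.le⟩ i5 fun t ht => ?_
    rw [← hs.greenIntegral_add hL G'.left.le G'.right.le i4 i5]
    have hq : (fun s => A s (z x s - z η s - v (x - η) s) + r x s) =
        fun s => f s (z x s) - f s (z η s) - A s (v (x - η) s) := by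
      funext s
      simp only [r, Δ, map_sub]
      abel
    rw [hq, hs.greenIntegral_sub hL G'.left.le G'.right.le i12 i3,
      hs.greenIntegral_sub hL G'.left.le G'.right.le i1 i2, (hz x).eq t ht, (hz η).eq t ht,
      hv'.eq t ht, map_sub]
    abel
  -- For fixed `s` this is differentiability of `f s` at `z η s`, combined with `z x s - z η s = O(x
  -- - η)`.
  have hpt : ∀ s ≤ τ, Tendsto (fun x => ‖x - η‖⁻¹ * ‖r x s‖) (𝓝 η) (𝓝 0) := fun s hst => by
    have hO : (fun x => z x s - z η s) =O[𝓝 η] fun x => x - η :=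
      Asymptotics.IsBigO.of_bound (C * Real.exp (-(σ * (s - τ))))
        (Eventually.of_forall fun x => (hΔ x s hst).trans (le_of_eq (by ring)))
    have hzt : Tendsto (fun x => z x s) (𝓝 η) (𝓝 (z η s)) := by
      have h0 : Tendsto (fun x => x - η) (𝓝 η) (𝓝 0) := by
        simpa using (continuous_id.sub continuous_const).tendsto (X := X) (f := fun x => x - η) η
      simpa using (hO.trans_tendsto h0).add_const (z η s)
    have ho := ((hasFDerivAt_iff_isLittleO.1 (hDf s (z η s))).comp_tendsto hzt).trans_isBigO hO
    have := ho.norm_norm.tendsto_div_nhds_zero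
    refine this.congr fun x => ?_
    rw [div_eq_inv_mul]
    rfl
  rw [hasFDerivAt_iff_tendsto]
  have hlim := (tendsto_weighted_integral_zero (l := 𝓝 η) (C := 2 * K * C) hσ
    (F := fun x s => ‖x - η‖⁻¹ * ‖r x s‖) (fun x s => by positivity)
    (fun x => ((hrm x).norm.const_mul _).restrict) (fun x s hst => by
      -- At `x = η` the convention `0⁻¹ = 0` makes the quotient vanish, so the majorant holds for
      -- every `x`.
      rcases eq_or_ne x η with rfl | hne
      · simp only [sub_self, norm_zero, inv_zero, zero_mul]
        positivity
      · have hpos : 0 < ‖x - η‖ := norm_pos_iff.2 (sub_ne_zero.2 hne)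
        rw [inv_mul_le_iff₀ hpos]
        exact (hr x s hst).trans (le_of_eq (by ring))) hpt).const_mul C'
  rw [mul_zero] at hlim
  refine squeeze_zero (fun x => by positivity) (fun x => ?_) hlim
  refine (mul_le_mul_of_nonneg_left (hmain x) (by positivity)).trans (le_of_eq ?_)
  rw [mul_left_comm, ← integral_const_mul]
  congr 2
  funext s
  ring

/-! ### Continuity of the derivative. -/

/-- An operator norm need not be attained. One vector that captures half of it reduces norm
convergence to a single solution for each `x`. -/
theorem exists_unit_almost_norming (B : X →L[𝕜] X) : ∃ h, ‖h‖ ≤ 1 ∧ ‖B‖ ≤ 2 * ‖B h‖ := by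
  rcases eq_or_lt_of_le (norm_nonneg B) with h0 | h0
  · exact ⟨0, by simp, by rw [← h0]; positivity⟩
  · obtain ⟨h, h1, h2⟩ := B.exists_lt_apply_of_lt_opNorm (half_lt_self h0)
    exact ⟨h, h1.le, by linarith⟩

/-- For the same datum, the difference of the linearised solutions along `z x` and `z η` is forced
by `(Df(s, z x s) - Df(s, z η s)) v(s)`, where `v` solves the equation along `z η`. Operator-norm
continuity of `Df s` makes this small for each `s`, even though the datum varies with `x` in the
unit ball. -/
theorem continuous_terminalValue [CompleteSpace X] (G : GapCondition L Q M γ ρ Γ L₁ L₂ σ)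
    (hf : Continuous fun p : ℝ × X => f p.1 p.2) (hg : IsSplitNonlinearity L Q γ ρ Γ L₁ L₂ f)
    (hDf : ∀ t u, HasFDerivAt (f t) (Df t u) u) (hDfc : ∀ t, Continuous (Df t))
    (hzc : ∀ η, Continuous (z η))
    (hz : ∀ η, IsMildSolution L Q γ ρ Γ f σ τ η (z η)) {E : X → X →L[𝕜] X}
    (hE : ∀ η h v, IsMildSolution L Q γ ρ Γ (fun s u => Df s (z η s) u) σ τ h v →
      E η h = v τ) : Continuous E := by
  have hL := G.process
  have hs := G.split
  obtain ⟨σ', hσ, G'⟩ := G.exists_larger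
  have hA := fun η =>
    isSplitNonlinearity_fderiv hs G.norm G.nonneg₁ G.nonneg₂ hf hg.lip hDf (hzc η)
  obtain ⟨C, hC0, hC⟩ := G.exists_lipschitz_const
  obtain ⟨K, hK0, hK⟩ := G.exists_lipschitz_norm
  obtain ⟨C', hC'0, hC'⟩ := G'.exists_forced_const
  choose v hvc hv using fun η => G.exists_mildSolution (hA η) τ
  rw [continuous_iff_continuousAt]
  intro η
  rw [ContinuousAt, tendsto_iff_norm_sub_tendsto_zero]
  choose h hh1 hh2 using fun x => exists_unit_almost_norming (E x - E η)
  have hvb : ∀ x, ∀ s ≤ τ, ‖v η (h x) s‖ ≤ C * Real.exp (-(σ * (s - τ))) := fun x s hst => by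
    have := hC _ (hA η) τ (h x) 0 _ _ (hv η (h x)) (G.isMildSolution_zero (hA η)) s hst
    rw [sub_zero, sub_zero] at this
    refine this.trans ?_
    gcongr
    exact mul_le_of_le_one_right hC0 (hh1 x)
  let r : X → ℝ → X := fun x s => Df s (z x s) (v η (h x) s) - Df s (z η s) (v η (h x) s)
  have hrm : ∀ x, AEStronglyMeasurable (r x) volume := fun x =>
    ((hA x).meas _ (hvc η (h x))).sub ((hA η).meas _ (hvc η (h x)))
  have hr : ∀ x, ∀ s ≤ τ, ‖r x s‖ ≤ 2 * K * C * Real.exp (-(σ * (s - τ))) := fun x s hst => by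
    have h1 := hK _ (hA x).lip s (v η (h x) s) 0
    have h2 := hK _ (hA η).lip s (v η (h x) s) 0
    simp only [map_zero, sub_zero] at h1 h2
    have h3 := mul_le_mul_of_nonneg_left (hvb x s hst) hK0
    exact ((norm_sub_le _ _).trans (add_le_add (h1.trans h3) (h2.trans h3))).trans
      (le_of_eq (by ring))
  have hpt : ∀ s ≤ τ, Tendsto (fun x => ‖r x s‖) (𝓝 η) (𝓝 0) := fun s hst => by
    have hzt : Tendsto (fun x => z x s) (𝓝 η) (𝓝 (z η s)) := by
      rw [tendsto_iff_norm_sub_tendsto_zero]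
      have h0 : Tendsto (fun x => C * ‖x - η‖ * Real.exp (-(σ * (s - τ)))) (𝓝 η) (𝓝 0) := by
        have : Continuous fun x : X => C * ‖x - η‖ * Real.exp (-(σ * (s - τ))) := by fun_prop
        simpa using this.tendsto η
      exact squeeze_zero (fun _ => norm_nonneg _)
        (fun x => hC f hg τ x η _ _ (hz x) (hz η) s hst) h0
    have h1 := (tendsto_iff_norm_sub_tendsto_zero.1
      (((hDfc s).tendsto (z η s)).comp hzt)).mul_const (C * Real.exp (-(σ * (s - τ))))
    rw [zero_mul] at h1
    refine squeeze_zero (fun _ => norm_nonneg _) (fun x => ?_) h1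
    simp only [r, ← sub_apply]
    exact ((Df s (z x s) - Df s (z η s)).le_opNorm _).trans
      (mul_le_mul_of_nonneg_left (hvb x s hst) (norm_nonneg _))
  have hmain : ∀ x, ‖E x - E η‖ ≤
      2 * (C' * ∫ s in Iic τ, Real.exp (σ' * (s - τ)) * ‖r x s‖) := fun x => by
    refine (hh2 x).trans (mul_le_mul_of_nonneg_left ?_ zero_le_two)
    have hx := hv x (h x)
    have hη := hv η (h x)
    rw [sub_apply, hE x _ _ hx, hE η _ _ hη]
    obtain ⟨B₁, hB₁⟩ := hx.bdd
    obtain ⟨B₂, hB₂⟩ := hη.bdd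
    have hwb := hB₁.sub hs G.norm hB₂
    have hwc := hx.cont.sub hη.cont
    have i1 := G.weightedIntegrable (hA x) hσ hx.cont hx.bdd
    have i2 := G.weightedIntegrable (hA η) hσ hη.cont hη.bdd
    have i3 : WeightedIntegrable σ' τ fun s => Df s (z x s) (v x (h x) s - v η (h x) s) :=
      G.weightedIntegrable (hA x) hσ hwc ⟨_, hwb⟩
    have i4 : WeightedIntegrable σ' τ (r x) :=
      weightedIntegrable_of_norm_le hσ (hrm x).restrict (hr x)
    refine hC' (fun s => Df s (z x s)) (hA x) τ (fun s => v x (h x) s - v η (h x) s) (r x) hwc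
      ⟨_, hwb.mono_exponent G.norm hσ.le⟩ i4 fun t ht => ?_
    rw [← hs.greenIntegral_add hL G'.left.le G'.right.le i3 i4]
    have hq : (fun s => Df s (z x s) (v x (h x) s - v η (h x) s) + r x s) =
        fun s => Df s (z x s) (v x (h x) s) - Df s (z η s) (v η (h x) s) := by
      funext s
      simp only [r, map_sub]
      abel
    rw [hq, hs.greenIntegral_sub hL G'.left.le G'.right.le i1 i2, hx.eq t ht, hη.eq t ht]
    abel
  have hlim := ((tendsto_weighted_integral_zero (l := 𝓝 η) (C := 2 * K * C) hσ
    (F := fun x s => ‖r x s‖) (fun x s => norm_nonneg _)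
    (fun x => (hrm x).norm.restrict) hr hpt).const_mul C').const_mul 2
  rw [mul_zero, mul_zero] at hlim
  exact squeeze_zero (fun x => norm_nonneg _) hmain hlim

end GapCondition

/-- The graph of a `C¹` map with values in the range of `I - P`, restricted to the range
of the projection `P`. -/
theorem isC1Graph_range {P : X →L[𝕜] X} {S : X → X} (hS : ContDiff 𝕜 1 S)
    (hPS : ∀ x, P (S x) = 0) :
    IsC1Graph (LinearMap.range P.toLinearMap)
      (LinearMap.range (ContinuousLinearMap.id 𝕜 X - P).toLinearMap)
      (range fun x => P x + S (P x)) := by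
  let R : X →L[𝕜] LinearMap.range (ContinuousLinearMap.id 𝕜 X - P).toLinearMap :=
    (ContinuousLinearMap.id 𝕜 X - P).codRestrict _ fun x => ⟨x, rfl⟩
  have hR : ∀ x, (R (S x) : X) = S x := fun x => by
    change S x - P (S x) = S x
    rw [hPS, sub_zero]
  refine ⟨fun n => R (S n),
    R.contDiff.comp (hS.comp (LinearMap.range P.toLinearMap).subtypeL.contDiff), ?_⟩
  ext y
  constructor
  · rintro ⟨x, rfl⟩
    exact ⟨⟨P x, x, rfl⟩, by simp only [hR]⟩
  · rintro ⟨⟨_, x, rfl⟩, rfl⟩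
    exact ⟨x, by simp only [hR]; rfl⟩

end

end InertialC1

end

/-! ### The `C¹` invariant manifold. -/

open InertialC1 in
theorem theorem6p1 {𝕜 : Type*} [RCLike 𝕜]
    {X : Type*} [NormedAddCommGroup X] [NormedSpace ℝ X] [NormedSpace 𝕜 X] [CompleteSpace X]
    -- the linear process and its exponential splitting
    (L : ℝ → ℝ → X →L[𝕜] X) (hL : IsLinearEvolutionProcess L)
    (Q : ℝ → X →L[𝕜] X) (M γ ρ : ℝ) (hsplit : HasExponentialSplitting L Q M γ ρ)
    -- the norm on the plane
    (Γ : ℝ × ℝ → ℝ) (hΓ : IsAdmissibleNorm Γ)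
    -- the nonlinearity
    (f : ℝ → X → X) (hf : Continuous (fun p : ℝ × X => f p.1 p.2))
    (hf0 : ∀ t : ℝ, f t 0 = 0)
    (L₁ L₂ : ℝ) (hL₁ : 0 < L₁) (hL₂ : 0 < L₂)
    (hLip : IsSplitLipschitz L Q γ ρ Γ f L₁ L₂)
    -- the nonlinear process
    (T : ℝ → ℝ → X → X) (hT : IsEvolutionProcess T) (hVCF : SatisfiesVCF L f T)
    -- the gap condition
    (σ : ℝ) (hρσ : ρ < σ) (hσγ : σ < γ)
    (hgap : Γ (L₁ / (σ - ρ), L₂ / (γ - σ)) < 1)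
    -- continuous Fréchet differentiability of the nonlinearity
    (Df : ℝ → X → X →L[𝕜] X)
    (hDf : ∀ (t : ℝ) (u : X), HasFDerivAt (f t) (Df t u) u)
    (hDfcont : ∀ t : ℝ, Continuous (Df t)) :
    ∃ (z : ℝ → X → ℝ → X) (Sig : ℝ → X → X),
      -- `z τ η` is the unique fixed point in the weighted space, and the improper integrals converge
      (∀ (τ : ℝ) (η : X), IsFixedPointH L Q γ ρ Γ f σ τ η (z τ η) ∧
        (∀ w : ℝ → X, IsFixedPointH L Q γ ρ Γ f σ τ η w → EqOn w (z τ η) (Iic τ)) ∧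
        ∀ t ≤ τ, IntegrableOn (stableIntegrand L Q f (z τ η) t) (Iic t)) ∧
      -- `Sig` is the function `Σ`
      (∀ (τ : ℝ) (η : X), Sig τ η = z τ η τ - Q τ (z τ η τ) ∧
        Sig τ η = ∫ s in Iic τ, stableIntegrand L Q f (z τ η) τ s) ∧
      -- its graphs form the invariant manifold
      (∀ t : ℝ, manifold L Q γ ρ Γ T σ t = range (fun η : X => Q t η + Sig t (Q t η))) ∧
      (∀ τ t : ℝ, τ ≤ t →
        T t τ '' manifold L Q γ ρ Γ T σ τ = manifold L Q γ ρ Γ T σ t) ∧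
      -- `Σ(τ, ·)` is Fréchet differentiable, with continuous derivative
      (∀ τ : ℝ, Differentiable 𝕜 (Sig τ)) ∧
      (∀ (τ : ℝ) (η : X),
        Tendsto (fun h : X => fderiv 𝕜 (Sig τ) (η + h)) (𝓝 0) (𝓝 (fderiv 𝕜 (Sig τ) η))) ∧
      -- the invariant manifold is a graph of class `C¹`
      (∀ t : ℝ, IsC1Graph (LinearMap.range (Q t).toLinearMap)
        (LinearMap.range (ContinuousLinearMap.id 𝕜 X - Q t).toLinearMap)
        (manifold L Q γ ρ Γ T σ t)) := by
  have G : GapCondition L Q M γ ρ Γ L₁ L₂ σ :=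
    ⟨hL, hsplit, hΓ, hρσ, hσγ, hL₁.le, hL₂.le, hgap⟩
  have hg : IsSplitNonlinearity L Q γ ρ Γ L₁ L₂ f :=
    isSplitNonlinearity_of_continuous hf hf0 hLip
  choose z hzc hz using G.exists_mildSolution hg
  have hA := fun τ η => isSplitNonlinearity_fderiv hsplit hΓ hL₁.le hL₂.le hf hLip hDf (hzc τ η)
  -- `E τ η` sends `h` to the value at `τ` of the linearised solution along `z τ η`. It is the
  -- derivative of `η ↦ z τ η τ`, and its stable part is that of `Sig τ`.
  choose E hE using fun τ η => G.exists_terminalValue (hA τ η) τ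
  have hder : ∀ τ η, HasFDerivAt (fun η => z τ η τ) (E τ η) η := fun τ η =>
    G.hasFDerivAt_mildSolution hf hg hDf (hzc τ) (hz τ) (hE τ η)
  have hEc : ∀ τ, Continuous (E τ) := fun τ =>
    G.continuous_terminalValue hf hg hDf hDfcont (hzc τ) (hz τ) (hE τ)
  let Sig : ℝ → X → X := fun τ η => z τ η τ - Q τ (z τ η τ)
  have hSig : ∀ τ η, HasFDerivAt (Sig τ) (E τ η - (Q τ).comp (E τ η)) η := fun τ η =>
    (hder τ η).sub ((Q τ).hasFDerivAt.comp η (hder τ η))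
  have hfd : ∀ τ, fderiv 𝕜 (Sig τ) = fun η => E τ η - (Q τ).comp (E τ η) := fun τ =>
    funext fun η => (hSig τ η).fderiv
  have hdiff : ∀ τ, Differentiable 𝕜 (Sig τ) := fun τ η => (hSig τ η).differentiableAt
  have hfdc : ∀ τ, Continuous (fderiv 𝕜 (Sig τ)) := fun τ => by
    rw [hfd]
    exact (hEc τ).sub (continuous_const.clm_comp (hEc τ))
  have hman : ∀ t, manifold L Q γ ρ Γ T σ t = range (fun η : X => Q t η + Sig t (Q t η)) :=
    fun t => G.manifold_eq_range hf hg hT hVCF (hz t)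
  refine ⟨z, Sig, fun τ η => ⟨(G.isFixedPointH_iff hg).2 (hz τ η), fun w hw =>
    G.mildSolution_unique hg ((G.isFixedPointH_iff hg).1 hw) (hz τ η), fun t ht =>
    G.integrableOn_stableIntegrand hg (hz τ η) ht⟩, fun τ η => ⟨rfl,
    G.stable_mildSolution hg (hz τ η)⟩, hman, fun τ t h => G.image_manifold hT h, hdiff,
    fun τ η => ?_, fun t => ?_⟩
  · have h : Continuous fun h : X => fderiv 𝕜 (Sig τ) (η + h) :=
      (hfdc τ).comp (continuous_const.add continuous_id)
    simpa using h.tendsto 0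
  · rw [hman]
    refine isC1Graph_range (contDiff_one_iff_fderiv.2 ⟨hdiff t, hfdc t⟩) fun η => ?_
    simp only [Sig, map_sub, hsplit.proj_apply, sub_self]
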